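/- Let $X_1,X_2,\dots$ (inter-server distances) and $Y_1,Y_2,\dots$ (inter-user distances) be mutually independent nonnegative random variables with finite variances, the $X_j$ identically distributed with mean $1/\mu>0$ and the $Y_i$ identically distributed with mean $1/\lambda>0$. Servers are located at $s_j=X_1+\dots+X_j$ and users at $r_i=Y_1+\dots+Y_i$ on $[0,\infty)$; every server can serve at most $c$ users, where $c$ is a positive integer, and $\rho=\lambda/\mu<c$. Consider two policies that allocate each user to a server at or to the right of its own location. Under Unidirectional Gale--Shapley (UGS), all users simultaneously emit rays to their right, and a user is allocated to the first server hit by its ray that has not yet been allocated to $c$ users. Under Move To Right (MTR), the users are considered one after the other from left to right, and each is allocated to the nearest server to its right that has not yet been allocated to $c$ users. (Coincident users and coincident servers are ordered by their index.) Let $D_i^U$ and $D_i^M$ be the distances between user $i$ and its server under UGS and MTR. Then, almost surely, every user is allocated to a server under both policies, all $D_i^U$ and $D_i^M$ have finite expectation, and the expected request distances of the two policies agree in steady state: (a) the long-run averages agree: $$\lim_{n\to\infty}\Big(\frac1n\sum_{i=1}^n \mathbb E[D_i^U]-\frac1n\sum_{i=1}^n \mathbb E[D_i^M]\Big)=0;$$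 (b) if $D^U$ and $D^M$ are steady-state request distances under UGS and MTR, that is, real random variables with $\frac1n\sum_{i=1}^n\mathbb E[f(D_i^P)]\to\mathbb E[f(D^P)]$ for every bounded continuous $f:\mathbb R\to\mathbb R$ and $P\in\{U,M\}$ (in particular if $D_i^P\to D^P$ in distribution), then both have finite expectation and $$\mathbb E[D^U]=\mathbb E[D^M].$$ -/

import Mathlib

open MeasureTheory ProbabilityTheory Filter Topology
open scoped BoundedContinuousFunction

/-- Location of the `n`-th point (numbered from `0`) of the point configuration on `[0, ∞)` with
successive gaps `gap 0, gap 1, …`, the first gap being measured from the origin. -/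
noncomputable def pointLocation (gap : ℕ → ℝ) (n : ℕ) : ℝ :=
  ∑ k ∈ Finset.range (n + 1), gap k

/-- Unidirectional Gale-Shapley with users at `r 0 ≤ r 1 ≤ …`, servers at `s 0 ≤ s 1 ≤ …` and `c`
places per server: the set of users allocated to server `j`. All users emit a ray to the right at
the same time. The rays that arrive at server `j` are those of the users at or to the left of
`s j` that no earlier server has absorbed, and the server absorbs the first `c` of them to arrive,
that is, those of the `c` nearest users. Coincident users are ordered by their index. -/
def ugsUsers (r s : ℕ → ℝ) (c : ℕ) (j : ℕ) : Set ℕ :=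
  {i | (r i ≤ s j ∧ ∀ k : Fin j, i ∉ ugsUsers r s c k) ∧
    {l | i < l ∧ r l ≤ s j ∧ ∀ k : Fin j, l ∉ ugsUsers r s c k}.encard < (c : ℕ∞)}
  termination_by j
  decreasing_by all_goals exact k.2

open Classical in
/-- The server of user `i` under Unidirectional Gale-Shapley, `none` if the user gets no server. -/
noncomputable def ugsServer (r s : ℕ → ℝ) (c : ℕ) (i : ℕ) : Option ℕ :=
  if h : ∃ j, i ∈ ugsUsers r s c j then some (Nat.find h) else none

open Classical in
/-- The server of user `i` under Move To Right, `none` if the user gets no server: the users choose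
one after the other from the left, and user `i` takes the nearest server at or to the right of `r i`
that has been taken by fewer than `c` of the preceding users. (As `s` is nondecreasing, the nearest
one is the one of least index.) -/
noncomputable def mtrServer (r s : ℕ → ℝ) (c : ℕ) (i : ℕ) : Option ℕ :=
  if h : ∃ j, r i ≤ s j ∧ {k : Fin i | mtrServer r s c k = some j}.encard < (c : ℕ∞) then
    some (Nat.find h)
  else none
  termination_by i
  decreasing_by all_goals exact k.2

/-- Distance between user `i` and its server under an allocation (`0` if there is no server). -/
noncomputable def requestDistance (r s : ℕ → ℝ) (server : ℕ → Option ℕ) (i : ℕ) : ℝ :=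
  match server i with
  | some j => s j - r i
  | none => 0

/-- The request distance of user `i` under Unidirectional Gale-Shapley, for inter-server distances
`X`, inter-user distances `Y` and server capacity `c`. -/
noncomputable def ugsDistance (X Y : ℕ → ℝ) (c : ℕ) (i : ℕ) : ℝ :=
  requestDistance (pointLocation Y) (pointLocation X)
    (ugsServer (pointLocation Y) (pointLocation X) c) i

/-- The request distance of user `i` under Move To Right, for inter-server distances
`X`, inter-user distances `Y` and server capacity `c`. -/
noncomputable def mtrDistance (X Y : ℕ → ℝ) (c : ℕ) (i : ℕ) : ℝ :=
  requestDistance (pointLocation Y) (pointLocation X)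
    (mtrServer (pointLocation Y) (pointLocation X) c) i

/-- `ν` is the steady-state law of the sequence `D 0, D 1, …` of random variables: the law of `D I`,
with `I` an independent uniform index below `n`, converges weakly to `ν` as `n → ∞`. This holds in
particular when the law of `D i` converges weakly to `ν`; the averaging also covers periodic
systems, such as those with deterministic distances. -/
def IsSteadyStateLaw {Ω : Type*} [MeasurableSpace Ω] (P : Measure Ω) (D : ℕ → Ω → ℝ)
    (ν : Measure ℝ) : Prop :=
  IsProbabilityMeasure ν ∧ ∀ f : ℝ →ᵇ ℝ,
    Tendsto (fun n : ℕ => (n : ℝ)⁻¹ * ∑ i ∈ Finset.range n, ∫ ω, f (D i ω) ∂P) atTop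
      (𝓝 (∫ x, f x ∂ν))

/-! Both policies are work-conserving: no unserved user passes a server with a free place. For all
such allocations the number of users absorbed by the first `j` servers is the same
(`IsWorkConserving.encard_lt_le`), hence so is the number of users whose trip covers a given point
`y`. Integrating over `y`, the total request distances of the first `n` users agree up to the part
of their trips beyond user `n`: the total under UGS exceeds that under MTR by at most the sum of
`(D_i^U - (r_n - r_i))⁺` (`IsWorkConserving.sum_le_sum_add`). Conversely, MTR is first come, first
served, and so minimises the sum of `(D_i - K)⁺` for every `K` (`IsWorkConserving.sum_stopLoss_le`).

The excess is `o(n)` in mean because the UGS distances are uniformly integrable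
(`exists_lintegral_ugs_le`): it is split into the tails `(D_i^U - K)⁺`, uniformly small in mean for
large `K`, and `(K - (r_n - r_i))⁺`, whose mean vanishes in the Cesàro sense because user locations
tend to infinity. MTR inherits the tail bounds on average, and uniform integrability turns limits of
averaged means into means of steady-state laws.

Uniform integrability is the probabilistic core. A user passed by servers under UGS sees all of them
filled by later users, so its distance is at most a functional `clearingDistance` of the future: the
reach of an excursion of a random walk whose drift is negative since `ρ < c`. A Wald-type argument
using the second moment of `X` bounds the mean of this functional, even when weighted by `1 +` the
first server gap. The weight is needed because the server gap in which a given user lands is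
size-biased; a renewal estimate (`exists_renewal_bound`) shows that this bias costs at most a
constant times that weight. -/

/-! ### Work-conserving allocations and their common counts. -/

/-- An allocation of users at `r` to servers at `s` of capacity `c` in which every user is served at
or to the right of its location, and no server with a free place is passed by an unserved user. -/
structure IsWorkConserving (r s : ℕ → ℝ) (c : ℕ) (σ : ℕ → ℕ) : Prop where
  le : ∀ i, r i ≤ s (σ i)
  encard_le : ∀ j, {i | σ i = j}.encard ≤ (c : ℕ∞)
  le_of_encard_lt : ∀ j, {i | σ i = j}.encard < (c : ℕ∞) → ∀ i, r i ≤ s j → σ i ≤ j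

namespace IsWorkConserving

variable {r s : ℕ → ℝ} {c : ℕ} {σ τ : ℕ → ℕ}

/-- Induction over the servers. If server `j` has a free place under `τ`, every user at or left of
it is served by then, which includes all users that `σ` has served. If it is full, `τ` gains `c`
users at `j` and `σ` gains no more. -/
lemma encard_lt_le (hσ : IsWorkConserving r s c σ) (hτ : IsWorkConserving r s c τ)
    (hs : Monotone s) (j : ℕ) : {i | σ i < j}.encard ≤ {i | τ i < j}.encard := by
  induction j with
  | zero => simp
  | succ j ih =>
    have split : ∀ f : ℕ → ℕ, {i | f i < j + 1} = {i | f i < j} ∪ {i | f i = j} := by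
      intro f; ext i; simp only [Set.mem_ofPred_eq, Set.mem_union]; omega
    by_cases h : {i | τ i = j}.encard < (c : ℕ∞)
    · refine Set.encard_le_encard fun i hi => ?_
      have h1 : σ i ≤ j := Nat.lt_succ_iff.1 hi
      exact Nat.lt_succ_iff.2 (hτ.le_of_encard_lt j h i ((hσ.le i).trans (hs h1)))
    · rw [split σ, split τ, Set.encard_union_eq (s := {i | τ i < j})]
      · exact (Set.encard_union_le _ _).trans
          (add_le_add ih ((hσ.encard_le j).trans (not_lt.1 h)))
      · rw [Set.disjoint_left]
        intro i hi hi'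
        simp only [Set.mem_ofPred_eq] at hi hi'
        omega

lemma encard_lt_eq (hσ : IsWorkConserving r s c σ) (hτ : IsWorkConserving r s c τ)
    (hs : Monotone s) (j : ℕ) : {i | σ i < j}.encard = {i | τ i < j}.encard :=
  le_antisymm (encard_lt_le hσ hτ hs j) (encard_lt_le hτ hσ hs j)

lemma encard_location_lt_eq (hσ : IsWorkConserving r s c σ) (hτ : IsWorkConserving r s c τ)
    (hs : Monotone s) (hs' : Tendsto s atTop atTop) (y : ℝ) :
    {i | s (σ i) < y}.encard = {i | s (τ i) < y}.encard := by
  classical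
  have hex : ∃ j, y ≤ s j := (hs'.eventually_ge_atTop y).exists
  have key : ∀ f : ℕ → ℕ, {i | s (f i) < y} = {i | f i < Nat.find hex} := by
    intro f
    ext i
    simp only [Set.mem_ofPred_eq]
    constructor
    · intro h
      by_contra! h'
      exact absurd ((Nat.find_spec hex).trans (hs h')) (not_le.2 h)
    · intro h
      exact not_le.1 (Nat.find_min hex h)
  rw [key, key, encard_lt_eq hσ hτ hs]

end IsWorkConserving

/-! ### Comparison of total waiting by integrating counts over levels. -/

lemma measurable_card_filter_Ioc (a b : ℕ → ℝ) (n : ℕ) :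
    Measurable fun y : ℝ =>
      (((Finset.range n).filter fun i => a i < y ∧ y ≤ b i).card : ENNReal) := by
  simp_rw [Finset.card_filter]
  push_cast
  exact Finset.measurable_fun_sum _ fun i _ =>
    Measurable.ite measurableSet_Ioc measurable_const measurable_const

/-- Layer-cake formula for a finite sum of lengths of intervals. -/
lemma sum_ofReal_sub_eq_lintegral (a b : ℕ → ℝ) (n : ℕ) :
    ∑ i ∈ Finset.range n, ENNReal.ofReal (b i - a i) =
      ∫⁻ y, (((Finset.range n).filter fun i => a i < y ∧ y ≤ b i).card : ENNReal) := by
  have h1 : ∀ i, ENNReal.ofReal (b i - a i) = ∫⁻ y, (Set.Ioc (a i) (b i)).indicator 1 y := by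
    intro i
    rw [lintegral_indicator_one measurableSet_Ioc, Real.volume_Ioc]
  simp_rw [h1]
  rw [← lintegral_finsetSum]
  · refine lintegral_congr fun y => ?_
    rw [Finset.card_filter]
    push_cast
    refine Finset.sum_congr rfl fun i _ => ?_
    simp [Set.indicator_apply]
  · intro i _
    exact measurable_one.indicator measurableSet_Ioc

namespace IsWorkConserving

variable {r s : ℕ → ℝ} {c : ℕ} {σ τ : ℕ → ℕ}

/-- First come, first served minimises every stop-loss functional of the waiting times. -/
lemma sum_stopLoss_le (hσ : IsWorkConserving r s c σ) (hτ : IsWorkConserving r s c τ)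
    (hr : Monotone r) (hs : Monotone s) (hs' : Tendsto s atTop atTop) (hmono : Monotone σ)
    (K : ℝ) (n : ℕ) :
    ∑ i ∈ Finset.range n, ENNReal.ofReal (s (σ i) - (r i + K)) ≤
      ∑ i ∈ Finset.range n, ENNReal.ofReal (s (τ i) - (r i + K)) := by
  rw [sum_ofReal_sub_eq_lintegral, sum_ofReal_sub_eq_lintegral]
  refine lintegral_mono fun y => ?_
  simp only [Nat.cast_le]
  set A := (Finset.range n).filter fun i => r i + K < y with hA
  set B : (ℕ → ℕ) → Finset ℕ := fun f => (Finset.range n).filter fun i => s (f i) < y with hB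
  have hAB : ∀ f : ℕ → ℕ,
      ((Finset.range n).filter fun i => r i + K < y ∧ y ≤ s (f i)) = A \ B f := by
    intro f; ext i; simp [hA, hB]; grind
  rw [hAB, hAB]
  -- If some `i₀` in `A` is still waiting at level `y`, monotonicity of `σ` confines the users
  -- served before `y` to indices below `i₀`. So `B σ` lies in `A` and is not cut off by `n`, while
  -- `B τ` is at most as large; removing it leaves at least as much of `A`.
  by_cases hsub : A ⊆ B σ
  · rw [Finset.sdiff_eq_empty_iff_subset.2 hsub]; simp
  obtain ⟨i₀, hi₀A, hi₀B⟩ := Finset.not_subset.1 hsub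
  have hi₀n : i₀ < n := Finset.mem_range.1 (Finset.mem_filter.1 hi₀A).1
  have hi₀y : y ≤ s (σ i₀) := by
    by_contra! h
    exact hi₀B (Finset.mem_filter.2 ⟨Finset.mem_range.2 hi₀n, h⟩)
  have hlt : ∀ i, s (σ i) < y → i < i₀ := by
    intro i hi
    by_contra! h
    exact absurd (hi₀y.trans (hs (hmono h))) (not_le.2 hi)
  have hBA : B σ ⊆ A := by
    intro i hi
    obtain ⟨hi1, hi2⟩ := Finset.mem_filter.1 hi
    refine Finset.mem_filter.2 ⟨hi1, lt_of_le_of_lt ?_ (Finset.mem_filter.1 hi₀A).2⟩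
    have := hr (hlt i hi2).le
    linarith
  have hcard : (B τ).card ≤ (B σ).card := by
    have h1 : ((B σ : Finset ℕ) : Set ℕ) = {i | s (σ i) < y} := by
      ext i
      simp only [hB, Finset.coe_filter, Finset.mem_range, Set.mem_ofPred_eq]
      exact ⟨fun h => h.2, fun h => ⟨(hlt i h).trans hi₀n, h⟩⟩
    have h2 : ((B τ : Finset ℕ) : Set ℕ) ⊆ {i | s (τ i) < y} := by
      intro i hi
      simp only [hB, Finset.coe_filter, Set.mem_ofPred_eq] at hi
      exact hi.2
    have h3 := Set.encard_le_encard h2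
    rw [encard_location_lt_eq hτ hσ hs hs' y, ← h1, Set.encard_coe_eq_coe_finsetCard,
      Set.encard_coe_eq_coe_finsetCard] at h3
    exact_mod_cast h3
  have h1 := Finset.card_sdiff_add_card_eq_card hBA
  have h2 := Finset.le_card_sdiff (B τ) A
  omega

/-- Up to the waiting still to be done when user `n` arrives, the total waiting times of the first
`n` users under two work-conserving allocations agree. -/
lemma sum_le_sum_add (hσ : IsWorkConserving r s c σ) (hτ : IsWorkConserving r s c τ)
    (hr : Monotone r) (hs : Monotone s) (hs' : Tendsto s atTop atTop) (n : ℕ) :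
    ∑ i ∈ Finset.range n, ENNReal.ofReal (s (σ i) - r i) ≤
      ∑ i ∈ Finset.range n, ENNReal.ofReal (s (τ i) - r i) +
        ∑ i ∈ Finset.range n, ENNReal.ofReal (s (σ i) - r n) := by
  rw [sum_ofReal_sub_eq_lintegral, sum_ofReal_sub_eq_lintegral,
    sum_ofReal_sub_eq_lintegral (fun _ => r n)]
  rw [← lintegral_add_left (measurable_card_filter_Ioc _ _ n)]
  refine lintegral_mono fun y => ?_
  rw [← Nat.cast_add, Nat.cast_le]
  -- Levels beyond `r n` are charged to the residual sum. For levels up to `r n`, all users located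
  -- or served left of `y` have index below `n`, so the truncation to `n` users is harmless and the
  -- two counts coincide.
  rcases lt_or_ge (r n) y with hy | hy
  · refine le_trans (Finset.card_le_card fun i hi => ?_) (Nat.le_add_left _ _)
    simp only [Finset.mem_filter] at hi ⊢
    exact ⟨hi.1, hy, hi.2.2⟩
  · refine le_trans (le_of_eq ?_) (Nat.le_add_right _ _)
    set A := (Finset.range n).filter fun i => r i < y with hA
    have hAn : ∀ i, r i < y → i < n := by
      intro i hi
      by_contra! h
      exact absurd (hy.trans (hr h)) (not_le.2 hi)
    set B : (ℕ → ℕ) → Finset ℕ := fun f => (Finset.range n).filter fun i => s (f i) < y with hB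
    have hAB : ∀ f : ℕ → ℕ,
        ((Finset.range n).filter fun i => r i < y ∧ y ≤ s (f i)) = A \ B f := by
      intro f; ext i; simp [hA, hB]; grind
    rw [hAB, hAB]
    have hBA : ∀ f : ℕ → ℕ, IsWorkConserving r s c f → B f ⊆ A ∧
        ((B f : Finset ℕ) : Set ℕ) = {i | s (f i) < y} := by
      intro f hf
      refine ⟨fun i hi => ?_, ?_⟩
      · obtain ⟨hi1, hi2⟩ := Finset.mem_filter.1 hi
        exact Finset.mem_filter.2 ⟨hi1, (hf.le i).trans_lt hi2⟩
      · ext i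
        simp only [hB, Finset.coe_filter, Finset.mem_range, Set.mem_ofPred_eq]
        exact ⟨fun h => h.2, fun h => ⟨hAn i ((hf.le i).trans_lt h), h⟩⟩
    have h3 := encard_location_lt_eq hσ hτ hs hs' y
    rw [← (hBA σ hσ).2, ← (hBA τ hτ).2, Set.encard_coe_eq_coe_finsetCard,
      Set.encard_coe_eq_coe_finsetCard] at h3
    have h3' : (B σ).card = (B τ).card := by exact_mod_cast h3
    rw [Finset.card_sdiff_of_subset (hBA σ hσ).1, Finset.card_sdiff_of_subset (hBA τ hτ).1, h3']

end IsWorkConserving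

/-! ### Move To Right is monotone and work-conserving. -/

section MoveToRight

variable {r s : ℕ → ℝ} {c : ℕ}

open Classical in
lemma mtrServer_exists (hc : 0 < c) (hs' : Tendsto s atTop atTop) (i : ℕ) :
    ∃ j, r i ≤ s j ∧ {k : Fin i | mtrServer r s c k = some j}.encard < (c : ℕ∞) := by
  obtain ⟨N, hN⟩ := eventually_atTop.1 (hs'.eventually_ge_atTop (r i))
  have hfin : (Set.range fun k : Fin i => mtrServer r s c k).Finite := Set.finite_range _
  have hfin' : (some ⁻¹' (Set.range fun k : Fin i => mtrServer r s c k)).Finite :=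
    hfin.preimage ((Option.some_injective _).injOn)
  obtain ⟨j, hj, hjN⟩ := (hfin'.infinite_compl.exists_gt N)
  refine ⟨j, hN j hjN.le, ?_⟩
  have : {k : Fin i | mtrServer r s c k = some j} = ∅ := by
    ext k
    simp only [Set.mem_ofPred_eq, Set.mem_empty_iff_false, iff_false]
    intro h
    exact hj ⟨k, h⟩
  rw [this, Set.encard_empty]
  exact_mod_cast hc

lemma fin_encard_eq (σ : ℕ → ℕ) (i j : ℕ) :
    {k : Fin i | σ k = j}.encard = {k | k < i ∧ σ k = j}.encard := by
  rw [← Function.Injective.encard_image (Fin.val_injective (n := i))]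
  congr 1
  ext k
  simp only [Set.mem_image, Set.mem_ofPred_eq]
  constructor
  · rintro ⟨a, ha, rfl⟩; exact ⟨a.2, ha⟩
  · rintro ⟨h1, h2⟩; exact ⟨⟨k, h1⟩, h2, rfl⟩

lemma exists_mtr (hc : 0 < c) (hr : Monotone r) (hs' : Tendsto s atTop atTop) :
    ∃ σ : ℕ → ℕ, (∀ i, mtrServer r s c i = some (σ i)) ∧ Monotone σ ∧
      IsWorkConserving r s c σ := by
  classical
  have hsome : ∀ i, ∃ j, mtrServer r s c i = some j := by
    intro i
    rw [mtrServer, dif_pos (mtrServer_exists hc hs' i)]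
    exact ⟨_, rfl⟩
  choose σ hσ using hsome
  have hfind : ∀ i, (r i ≤ s (σ i) ∧ {k | k < i ∧ σ k = σ i}.encard < (c : ℕ∞)) ∧
      ∀ j, r i ≤ s j → {k | k < i ∧ σ k = j}.encard < (c : ℕ∞) → σ i ≤ j := by
    intro i
    have h1 := hσ i
    rw [mtrServer, dif_pos (mtrServer_exists hc hs' i), Option.some_inj] at h1
    have hcard : ∀ j, {k : Fin i | mtrServer r s c k = some j}.encard =
        {k | k < i ∧ σ k = j}.encard := by
      intro j
      rw [← fin_encard_eq]
      congr 1
      ext k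
      simp [hσ]
    constructor
    · have := Nat.find_spec (mtrServer_exists (r := r) hc hs' i)
      rw [h1, hcard] at this
      exact this
    · intro j hj1 hj2
      rw [← h1]
      exact Nat.find_min' _ ⟨hj1, by rw [hcard]; exact hj2⟩
  -- The server chosen by a later user was also available to an earlier one, since fewer users had
  -- chosen before.
  have hmono : Monotone σ := by
    intro i i' hii
    refine (hfind i).2 _ ((hr hii).trans (hfind i').1.1) ?_
    refine lt_of_le_of_lt (Set.encard_le_encard fun k hk => ?_) (hfind i').1.2
    exact ⟨hk.1.trans_le hii, hk.2⟩
  refine ⟨σ, hσ, hmono, fun i => (hfind i).1.1, fun j => ?_, fun j hj i hi => ?_⟩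
  -- Among `c + 1` users of one server, the one of largest index would have found `c` places already
  -- taken.
  · by_contra! h
    obtain ⟨t, hts, htc⟩ := Set.exists_subset_encard_eq (Order.add_one_le_of_lt h)
    have htf : t.Finite := Set.finite_of_encard_eq_coe (k := c + 1) (by rw [htc]; push_cast; rfl)
    have htne : t.Nonempty := by
      rw [← Set.encard_pos, htc]
      exact_mod_cast Nat.succ_pos c
    obtain ⟨m, hm, hmax⟩ := htf.exists_maximalFor id t htne
    have hsub : t \ {m} ⊆ {k | k < m ∧ σ k = σ m} := by
      rintro k ⟨hk, hkm⟩
      have h1 : ¬ m < k := fun hlt => absurd (hmax hk hlt.le) (not_le.2 hlt)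
      have h2 : k ≠ m := hkm
      have h3 : σ k = j := hts hk
      have h4 : σ m = j := hts hm
      exact ⟨by omega, by omega⟩
    have h1 := Set.encard_sdiff_singleton_add_one hm
    rw [htc] at h1
    have h2 := (Set.encard_le_encard hsub).trans_lt (hfind m).1.2
    have h3 : (t \ {m}).encard = (c : ℕ∞) :=
      (ENat.add_left_injective_of_ne_top (by simp) h1)
    rw [h3] at h2
    exact lt_irrefl _ h2
  · refine (hfind i).2 j hi (lt_of_le_of_lt (Set.encard_le_encard fun k hk => hk.2) hj)

end MoveToRight

/-! ### Unidirectional Gale–Shapley is work-conserving and passes a user only at full servers. -/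

section TopElements

variable {A : Set ℕ} {c : ℕ}

/-- The `c` largest elements of a set of natural numbers. -/
def topElements (A : Set ℕ) (c : ℕ) : Set ℕ :=
  {i | i ∈ A ∧ {l | i < l ∧ l ∈ A}.encard < (c : ℕ∞)}

/-- All other members lie above the least member, which has fewer than `c` elements of `A` above it.
-/
lemma topElements_encard_le (A : Set ℕ) (c : ℕ) : (topElements A c).encard ≤ c := by
  rcases (topElements A c).eq_empty_or_nonempty with h | h
  · simp [h]
  classical
  have hm := Nat.find_spec h
  set m := Nat.find h
  have hsub : topElements A c \ {m} ⊆ {l | m < l ∧ l ∈ A} := by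
    rintro l ⟨hl, hlm⟩
    exact ⟨lt_of_le_of_ne (Nat.find_min' h hl) (Ne.symm hlm), hl.1⟩
  rw [← Set.encard_sdiff_singleton_add_one hm]
  exact Order.add_one_le_of_lt ((Set.encard_le_encard hsub).trans_lt hm.2)

lemma lt_of_mem_topElements {i l : ℕ} (hi : i ∈ A) (hiT : i ∉ topElements A c)
    (hl : l ∈ topElements A c) : i < l := by
  by_contra! h
  refine hiT ⟨hi, lt_of_le_of_lt (Set.encard_le_encard fun k hk => ?_) hl.2⟩
  exact ⟨h.trans_lt hk.1, hk.2⟩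

/-- The greatest excluded element has at least `c` elements of `A` above it, and none of those is
excluded. -/
lemma le_topElements_encard (hA : A.Finite) {i : ℕ} (hi : i ∈ A) (hiT : i ∉ topElements A c) :
    (c : ℕ∞) ≤ (topElements A c).encard := by
  by_contra! h
  obtain ⟨m, hm, hmax⟩ := (hA.subset (Set.sdiff_subset (s := A) (t := topElements A c))).exists_maximalFor
    id _ ⟨i, hi, hiT⟩
  refine hm.2 ⟨hm.1, lt_of_le_of_lt (Set.encard_le_encard fun k hk => ?_) h⟩
  by_contra hkT
  exact absurd (hmax ⟨hk.2, hkT⟩ hk.1.le) (not_le.2 hk.1)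

end TopElements

section UGS

variable {r s : ℕ → ℝ} {c : ℕ}

/-- The users whose rays reach server `j` under unidirectional Gale-Shapley. -/
def ugsArrivals (r s : ℕ → ℝ) (c j : ℕ) : Set ℕ :=
  {i | r i ≤ s j ∧ ∀ k < j, i ∉ ugsUsers r s c k}

lemma ugsUsers_eq (r s : ℕ → ℝ) (c j : ℕ) :
    ugsUsers r s c j = topElements (ugsArrivals r s c j) c := by
  rw [ugsUsers]
  simp only [topElements, ugsArrivals, Fin.forall_iff, Set.mem_ofPred_eq]

lemma finite_ugsArrivals (hr' : Tendsto r atTop atTop) (j : ℕ) : (ugsArrivals r s c j).Finite := by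
  have h := hr'.eventually_gt_atTop (s j)
  rw [← Nat.cofinite_eq_atTop, Filter.eventually_cofinite] at h
  exact h.subset fun i hi => not_lt.2 hi.1

lemma ugsUsers_unique {i j k : ℕ} (hj : i ∈ ugsUsers r s c j) (hk : i ∈ ugsUsers r s c k) :
    j = k := by
  have key : ∀ {j k : ℕ}, i ∈ ugsUsers r s c j → i ∈ ugsUsers r s c k → ¬ j < k := by
    intro j k hj hk h
    rw [ugsUsers_eq r s c k] at hk
    exact hk.1.2 j h hj
  exact le_antisymm (not_lt.1 (key hk hj)) (not_lt.1 (key hj hk))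

/-- If user `i` is passed by `k + 1` servers, then these are filled by later users. -/
lemma le_of_forall_notMem_ugsUsers (hr : Monotone r) (hs : Monotone s)
    (hr' : Tendsto r atTop atTop) {i J k : ℕ} (hJ : r i ≤ s J) (hJ' : ∀ j < J, s j < r i)
    (h : ∀ m ≤ k, i ∉ ugsUsers r s c (J + m)) : r (i + c * (k + 1)) ≤ s (J + k) := by
  have hlt : ∀ j < J, i ∉ ugsUsers r s c j := by
    intro j hj hi
    rw [ugsUsers_eq] at hi
    exact absurd hi.1.1 (not_le.2 (hJ' j hj))
  have harr : ∀ m ≤ k, i ∈ ugsArrivals r s c (J + m) := by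
    intro m hm
    refine ⟨hJ.trans (hs (Nat.le_add_right _ _)), fun j hj => ?_⟩
    rcases lt_or_ge j J with h1 | h1
    · exact hlt j h1
    · obtain ⟨d, rfl⟩ := Nat.exists_eq_add_of_le h1
      exact h d (by omega)
  -- A server that leaves out `i` is full, and distinct servers absorb disjoint sets of users.
  have hcount : ∀ m ≤ k, ((c * (m + 1) : ℕ) : ℕ∞) ≤
      (⋃ d ∈ Finset.range (m + 1), ugsUsers r s c (J + d)).encard := by
    intro m hm
    have hfull : ∀ m ≤ k, (c : ℕ∞) ≤ (ugsUsers r s c (J + m)).encard := by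
      intro m hm
      have h1 := h m hm
      rw [ugsUsers_eq] at h1 ⊢
      exact le_topElements_encard (finite_ugsArrivals hr' _) (harr m hm) h1
    induction m with
    | zero => simpa using hfull 0 hm
    | succ m ih =>
      rw [Finset.range_add_one, Finset.set_biUnion_insert, Set.encard_union_eq]
      · have h1 := add_le_add (hfull (m + 1) hm) (ih (by omega))
        refine le_trans (le_of_eq ?_) h1
        push_cast; ring
      · rw [Set.disjoint_left]
        intro l hl hl'
        simp only [Set.mem_iUnion, Finset.mem_range] at hl'
        obtain ⟨d, hd, hd'⟩ := hl'
        have := ugsUsers_unique hl hd'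
        omega
  have hsub : (⋃ d ∈ Finset.range (k + 1), ugsUsers r s c (J + d)) ⊆ {l | i < l ∧ r l ≤ s (J + k)} := by
    intro l hl
    simp only [Set.mem_iUnion, Finset.mem_range] at hl
    obtain ⟨d, hd, hl⟩ := hl
    have h1 := h d (by omega)
    rw [ugsUsers_eq] at hl h1
    exact ⟨lt_of_mem_topElements (harr d (by omega)) h1 hl,
      hl.1.1.trans (hs (by omega))⟩
  -- Otherwise the `c * (k + 1)` absorbed users would have indices strictly between `i` and `i + c *
  -- (k + 1)`, one too few. The case `c = 0` is separate because there the natural subtraction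
  -- yields no contradiction.
  by_contra! hcon
  have hsub' : {l | i < l ∧ r l ≤ s (J + k)} ⊆ ((Finset.Ioo i (i + c * (k + 1)) : Finset ℕ) : Set ℕ) := by
    intro l hl
    rw [Finset.coe_Ioo]
    refine ⟨hl.1, ?_⟩
    by_contra! hcl
    exact absurd ((hr hcl).trans hl.2) (not_le.2 hcon)
  have h1 := (hcount k le_rfl).trans (Set.encard_le_encard (hsub.trans hsub'))
  rw [Set.encard_coe_eq_coe_finsetCard, Nat.card_Ioo] at h1
  have h2 : c * (k + 1) ≤ i + c * (k + 1) - i - 1 := by exact_mod_cast h1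
  rcases Nat.eq_zero_or_pos (c * (k + 1)) with h0 | h0
  · rw [h0, add_zero] at hcon
    exact absurd (hJ.trans (hs (Nat.le_add_right J k))) (not_le.2 hcon)
  · omega

lemma ugs_isWorkConserving (hr' : Tendsto r atTop atTop) {σ : ℕ → ℕ}
    (hσ : ∀ i, i ∈ ugsUsers r s c (σ i)) : IsWorkConserving r s c σ := by
  have hfib : ∀ j, {i | σ i = j} = ugsUsers r s c j := by
    intro j
    ext i
    exact ⟨fun h => h ▸ hσ i, fun h => ugsUsers_unique (hσ i) h⟩
  refine ⟨fun i => ?_, fun j => ?_, fun j hj i hi => ?_⟩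
  · have := hσ i
    rw [ugsUsers_eq] at this
    exact this.1.1
  · rw [hfib, ugsUsers_eq]
    exact topElements_encard_le _ _
  · by_contra! hlt
    have hA : i ∈ ugsArrivals r s c j :=
      ⟨hi, fun k hk hik => by have := ugsUsers_unique (hσ i) hik; omega⟩
    rw [hfib, ugsUsers_eq] at hj
    refine absurd (le_topElements_encard (finite_ugsArrivals hr' j) hA fun h => ?_) (not_le.2 hj)
    rw [← ugsUsers_eq] at h
    have := ugsUsers_unique (hσ i) h
    omega

lemma ugsServer_eq_some_iff {i j : ℕ} : ugsServer r s c i = some j ↔ i ∈ ugsUsers r s c j := by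
  classical
  unfold ugsServer
  split_ifs with h
  · rw [Option.some_inj]
    exact ⟨fun e => e ▸ Nat.find_spec h, fun e => ugsUsers_unique (Nat.find_spec h) e⟩
  · simp only [false_iff]
    exact fun e => h ⟨j, e⟩

end UGS

/-! ### Pathwise bound of the UGS distance by the clearing distance. -/

section Paths

/-- The users after a given one outnumber the places of the first `m + 1` servers, for all `m ≤ k`.
Here `x` are the gaps of the servers and `y` those of the users. -/
def IsOverloaded (c : ℕ) (x y : ℕ → ℝ) (k : ℕ) : Prop :=
  ∀ m ≤ k, ∑ l ∈ Finset.range (c * (m + 1)), y l ≤ ∑ l ∈ Finset.range (m + 1), x l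

open Classical in
/-- The distance to the first server that is not kept busy by later users. -/
noncomputable def clearingDistance (c : ℕ) (x y : ℕ → ℝ) : ENNReal :=
  ENNReal.ofReal (x 0) +
    ∑' k, if IsOverloaded c x y k then ENNReal.ofReal (x (k + 1)) else 0

lemma monotone_pointLocation {x : ℕ → ℝ} (hx : ∀ n, 0 ≤ x n) : Monotone (pointLocation x) :=
  monotone_nat_of_le_succ fun n => by
    unfold pointLocation
    rw [Finset.sum_range_succ _ (n + 1)]
    linarith [hx (n + 1)]

lemma tendsto_pointLocation_div {x : ℕ → ℝ} {a : ℝ}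
    (h : Tendsto (fun n : ℕ => (∑ k ∈ Finset.range n, x k) / n) atTop (𝓝 a)) :
    Tendsto (fun n : ℕ => pointLocation x n / ((n + 1 : ℕ) : ℝ)) atTop (𝓝 a) :=
  h.comp (tendsto_add_atTop_nat 1)

lemma tendsto_pointLocation {x : ℕ → ℝ} {a : ℝ} (ha : 0 < a)
    (h : Tendsto (fun n : ℕ => (∑ k ∈ Finset.range n, x k) / n) atTop (𝓝 a)) :
    Tendsto (pointLocation x) atTop atTop := by
  have h1 := (tendsto_pointLocation_div h).pos_mul_atTop ha
    (tendsto_natCast_atTop_atTop.comp (tendsto_add_atTop_nat 1))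
  refine h1.congr fun n => ?_
  have : ((n + 1 : ℕ) : ℝ) ≠ 0 := by positivity
  simp only [Function.comp_apply]
  field_simp

lemma pointLocation_add_sub (x : ℕ → ℝ) (i n : ℕ) :
    pointLocation x (i + n) = pointLocation x i + ∑ l ∈ Finset.range n, x (i + 1 + l) := by
  unfold pointLocation
  rw [show i + n + 1 = (i + 1) + n by ring, Finset.sum_range_add]

lemma pointLocation_add_eq (x : ℕ → ℝ) (i n : ℕ) :
    pointLocation x (i + n) =
      ∑ k ∈ Finset.range i, x k + ∑ l ∈ Finset.range (n + 1), x (i + l) := by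
  unfold pointLocation
  rw [show i + n + 1 = i + (n + 1) by ring, Finset.sum_range_add]

/-- Take `j` to be the first server at or right of user `i`. As long as servers from `j` on pass the
user, later users overload them, so each further gap crossed is a term of the clearing distance. The
gap `x j` containing the user is counted in full. -/
lemma exists_ugs {x y : ℕ → ℝ} {a b : ℝ} {c : ℕ} (hx : ∀ n, 0 ≤ x n) (hy : ∀ n, 0 ≤ y n)
    (ha : 0 < a) (hb : 0 < b) (hab : a < c * b)
    (hxa : Tendsto (fun n : ℕ => (∑ k ∈ Finset.range n, x k) / n) atTop (𝓝 a))
    (hyb : Tendsto (fun n : ℕ => (∑ k ∈ Finset.range n, y k) / n) atTop (𝓝 b)) :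
    ∃ σ : ℕ → ℕ, (∀ i, ugsServer (pointLocation y) (pointLocation x) c i = some (σ i)) ∧
      IsWorkConserving (pointLocation y) (pointLocation x) c σ ∧
      ∀ i, ∃ j, ∑ k ∈ Finset.range j, x k ≤ pointLocation y i ∧
        pointLocation y i ≤ ∑ k ∈ Finset.range (j + 1), x k ∧
        ENNReal.ofReal (pointLocation x (σ i) - pointLocation y i) ≤
          clearingDistance c (fun l => x (j + l)) (fun l => y (i + 1 + l)) := by
  classical
  have hr := monotone_pointLocation hy
  have hs := monotone_pointLocation hx
  have hr' := tendsto_pointLocation hb hyb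
  have hs' := tendsto_pointLocation ha hxa
  set r := pointLocation y with hrdef
  set s := pointLocation x with hsdef
  have hJex : ∀ i, ∃ j, r i ≤ s j := fun i => (hs'.eventually_ge_atTop (r i)).exists
  have hpass : ∀ i k, (∀ m ≤ k, i ∉ ugsUsers r s c (Nat.find (hJex i) + m)) →
      r (i + c * (k + 1)) ≤ s (Nat.find (hJex i) + k) := fun i k h =>
    le_of_forall_notMem_ugsUsers hr hs hr' (Nat.find_spec (hJex i))
      (fun j hj => not_le.1 (Nat.find_min (hJex i) hj)) h
  have hserved : ∀ i, ∃ j, i ∈ ugsUsers r s c j := by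
    intro i
    by_contra! hno
    set J := Nat.find (hJex i)
    have hc : 0 < c := by
      rcases Nat.eq_zero_or_pos c with h0 | h0
      · rw [h0, Nat.cast_zero, zero_mul] at hab; linarith
      · exact h0
    -- If the user is passed forever, dividing by `k + 1` and using the average gaps gives `c * b ≤
    -- a` in the limit, against `hab`.
    have h1 : ∀ k : ℕ, r (i + c * (k + 1)) / ((k + 1 : ℕ) : ℝ) ≤
        s (J + 1 * (k + 1)) / ((k + 1 : ℕ) : ℝ) := fun k =>
      div_le_div_of_nonneg_right ((hpass i k fun m _ => hno _).trans (hs (by omega)))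
        (by positivity)
    have lim : ∀ (f : ℕ → ℝ) (u : ℝ) (d e : ℕ), 0 < d →
        Tendsto (fun n : ℕ => f n / ((n + 1 : ℕ) : ℝ)) atTop (𝓝 u) →
        Tendsto (fun k : ℕ => f (e + d * (k + 1)) / ((k + 1 : ℕ) : ℝ)) atTop (𝓝 (u * d)) := by
      intro f u d e hd hf
      have t1 : Tendsto (fun k : ℕ => e + d * (k + 1)) atTop atTop := by
        refine tendsto_atTop_mono (fun k => ?_) tendsto_id
        simp only [id]
        nlinarith
      have t2 : Tendsto (fun k : ℕ => ((e + d * (k + 1) + 1 : ℕ) : ℝ) / ((k + 1 : ℕ) : ℝ))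
          atTop (𝓝 d) := by
        have t3 : Tendsto (fun k : ℕ => (d : ℝ) + (e + 1 : ℝ) * (1 / ((k : ℝ) + 1))) atTop
            (𝓝 (d + (e + 1) * 0)) :=
          tendsto_const_nhds.add (tendsto_const_nhds.mul tendsto_one_div_add_atTop_nhds_zero_nat)
        rw [mul_zero, add_zero] at t3
        refine t3.congr fun k => ?_
        have : ((k : ℝ) + 1) ≠ 0 := by positivity
        push_cast
        field_simp
        ring
      refine ((hf.comp t1).mul t2).congr fun k => ?_
      have h3 : ((e + d * (k + 1) + 1 : ℕ) : ℝ) ≠ 0 := by positivity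
      simp only [Function.comp_apply]
      field_simp
    have l1 := lim r b c i hc (tendsto_pointLocation_div hyb)
    have l2 := lim s a 1 J one_pos (tendsto_pointLocation_div hxa)
    rw [Nat.cast_one, mul_one] at l2
    have := le_of_tendsto_of_tendsto' l1 l2 h1
    linarith [mul_comm (c : ℝ) b]
  choose σ hσ using hserved
  have hWC := ugs_isWorkConserving hr' hσ
  refine ⟨σ, fun i => ugsServer_eq_some_iff.2 (hσ i), hWC, fun i => ?_⟩
  set J := Nat.find (hJex i) with hJ
  have hSJ : ∑ k ∈ Finset.range J, x k ≤ r i := by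
    rcases Nat.eq_zero_or_pos J with h0 | h0
    · rw [h0, Finset.sum_range_zero, hrdef]
      exact Finset.sum_nonneg fun k _ => hy k
    · have := Nat.find_min (hJex i) (m := J - 1) (by omega)
      have h2 : s (J - 1) = ∑ k ∈ Finset.range J, x k := by
        rw [hsdef, pointLocation, Nat.sub_add_cancel h0]
      rw [h2] at this
      exact (not_le.1 this).le
  refine ⟨J, hSJ, Nat.find_spec (hJex i), ?_⟩
  have hJσ : J ≤ σ i := Nat.find_min' _ (hWC.le i)
  obtain ⟨d, hd⟩ := Nat.exists_eq_add_of_le hJσ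
  have hover : ∀ k < d, IsOverloaded c (fun l => x (J + l)) (fun l => y (i + 1 + l)) k := by
    intro k hk m hm
    have h1 : pointLocation y (i + c * (m + 1)) ≤ pointLocation x (J + m) :=
      hpass i m fun m' hm' hmem => by
        have := ugsUsers_unique (hσ i) hmem
        omega
    rw [pointLocation_add_sub, pointLocation_add_eq, ← hrdef] at h1
    linarith
  calc ENNReal.ofReal (s (σ i) - r i)
      ≤ ENNReal.ofReal (x (J + 0) + ∑ k ∈ Finset.range d, x (J + (k + 1))) := by
        refine ENNReal.ofReal_le_ofReal ?_
        rw [hd, hsdef, pointLocation_add_eq, Finset.sum_range_succ']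
        linarith
    _ = ENNReal.ofReal (x (J + 0)) + ∑ k ∈ Finset.range d, ENNReal.ofReal (x (J + (k + 1))) := by
        rw [ENNReal.ofReal_add (hx _) (Finset.sum_nonneg fun k _ => hx _),
          ENNReal.ofReal_sum_of_nonneg fun k _ => hx _]
    _ ≤ _ := by
        refine add_le_add le_rfl (le_trans (Finset.sum_le_sum fun k hk => ?_)
          (ENNReal.sum_le_tsum (Finset.range d)))
        rw [if_pos (hover k (Finset.mem_range.1 hk))]

end Paths

/-! ### Independence of functions of disjoint coordinates. -/

section Independence

/-- Setting the coordinates outside `S` to `0` does not change `f`, and leaves a function of the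
coordinates in `S` only. -/
lemma measurable_iSup_comap_comp_of_dependsOn {Ω ι β : Type*} [MeasurableSpace β]
    {F : ι → Ω → ℝ} {f : (ι → ℝ) → β} (hf : Measurable f) {S : Set ι} (hS : DependsOn f S) :
    Measurable[⨆ i ∈ S, MeasurableSpace.comap (F i) inferInstance] fun ω => f fun i => F i ω := by
  classical
  have heq : (fun ω => f fun i => F i ω) =
      f ∘ fun ω i => if i ∈ S then F i ω else 0 := by
    ext ω
    exact hS fun i hi => (if_pos hi).symm
  rw [heq]
  refine hf.comp ((@measurable_pi_iff _ _ _ (_) _ _).2 fun i => ?_)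
  by_cases hi : i ∈ S
  · simp only [hi, if_true]
    exact (comap_measurable (F i)).mono
      (le_iSup₂ (f := fun i (_ : i ∈ S) => MeasurableSpace.comap (F i) inferInstance) i hi) le_rfl
  · simp only [hi, if_false]
    exact measurable_const

/-- Measurable functions of disjoint sets of coordinates of an independent family are independent. -/
lemma iIndepFun.indepFun_of_dependsOn {Ω ι β γ : Type*} [MeasurableSpace Ω] {P : Measure Ω}
    [MeasurableSpace β] [MeasurableSpace γ]
    {F : ι → Ω → ℝ} (hF : ∀ i, Measurable (F i)) (h : iIndepFun F P)
    {f : (ι → ℝ) → β} {g : (ι → ℝ) → γ} (hf : Measurable f) (hg : Measurable g) {S T : Set ι}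
    (hST : Disjoint S T) (hS : DependsOn f S) (hT : DependsOn g T) :
    IndepFun (fun ω => f fun i => F i ω) (fun ω => g fun i => F i ω) P := by
  have h1 := indep_iSup_of_disjoint (fun i => (hF i).comap_le) h hST
  exact indep_of_indep_of_le_left (indep_of_indep_of_le_right h1
    (measurable_iSup_comap_comp_of_dependsOn hg hT).comap_le)
    (measurable_iSup_comap_comp_of_dependsOn hf hS).comap_le

end Independence

/-! ### Pairs of renewal processes and their shifts. -/

/-- The gaps of the servers, `F (Sum.inl j)`, and of the users, `F (Sum.inr i)`, of a pair of
independent renewal processes. -/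
structure IsRenewalPair {Ω : Type*} [MeasurableSpace Ω] (P : Measure Ω)
    (F : ℕ ⊕ ℕ → Ω → ℝ) : Prop where
  measurable : ∀ k, Measurable (F k)
  indep : iIndepFun F P
  identDistrib_inl : ∀ j, IdentDistrib (F (Sum.inl j)) (F (Sum.inl 0)) P P
  identDistrib_inr : ∀ i, IdentDistrib (F (Sum.inr i)) (F (Sum.inr 0)) P P
  nonneg : ∀ᵐ ω ∂P, ∀ k, 0 ≤ F k ω
  memLp : MemLp (F (Sum.inl 0)) 2 P
  integrable : Integrable (F (Sum.inr 0)) P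

/-- The path of the two renewal processes after the first `a` servers and the first `b` users. -/
def shiftedPath {Ω : Type*} (F : ℕ ⊕ ℕ → Ω → ℝ) (a b : ℕ) (ω : Ω) : ℕ ⊕ ℕ → ℝ :=
  fun k => F (Sum.map (a + ·) (b + ·) k) ω

namespace IsRenewalPair

variable {Ω : Type*} [MeasurableSpace Ω] {P : Measure Ω} {F : ℕ ⊕ ℕ → Ω → ℝ}

lemma measurable_path (h : IsRenewalPair P F) : Measurable fun ω k => F k ω :=
  measurable_pi_iff.2 h.measurable

lemma measurable_shiftedPath (h : IsRenewalPair P F) (a b : ℕ) : Measurable (shiftedPath F a b) :=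
  measurable_pi_iff.2 fun _ => h.measurable _

/-- By independence both laws are infinite products, with the same marginals. -/
lemma map_shiftedPath (h : IsRenewalPair P F) (a b : ℕ) :
    P.map (shiftedPath F a b) = P.map fun ω k => F k ω := by
  have hinj : Function.Injective (Sum.map (a + ·) (b + ·) : ℕ ⊕ ℕ → ℕ ⊕ ℕ) :=
    Function.Injective.sumMap (add_right_injective a) (add_right_injective b)
  have h1 := (h.indep.precomp hinj).map_fun_eq_infinitePi_map fun k => h.measurable _
  have h2 := h.indep.map_fun_eq_infinitePi_map h.measurable
  refine Eq.trans h1 (Eq.trans ?_ h2.symm)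
  congr 1
  funext k
  rcases k with j | i
  · exact (h.identDistrib_inl _).map_eq.trans (h.identDistrib_inl j).map_eq.symm
  · exact (h.identDistrib_inr _).map_eq.trans (h.identDistrib_inr i).map_eq.symm

lemma identDistrib_shiftedPath (h : IsRenewalPair P F) (a b : ℕ) :
    IdentDistrib (shiftedPath F a b) (fun ω k => F k ω) P P :=
  ⟨(h.measurable_shiftedPath a b).aemeasurable, h.measurable_path.aemeasurable,
    h.map_shiftedPath a b⟩

lemma integrable_inl [IsProbabilityMeasure P] (h : IsRenewalPair P F) (j : ℕ) : Integrable (F (Sum.inl j)) P :=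
  (h.identDistrib_inl j).integrable_iff.2 (h.memLp.integrable one_le_two)

lemma memLp_const_add [IsProbabilityMeasure P] (h : IsRenewalPair P F) (a : ℝ) :
    MemLp (fun ω => a + F (Sum.inl 0) ω) 2 P :=
  MemLp.add (memLp_const a) h.memLp

lemma integrable_inr (h : IsRenewalPair P F) (i : ℕ) : Integrable (F (Sum.inr i)) P :=
  (h.identDistrib_inr i).integrable_iff.2 h.integrable

end IsRenewalPair

/-! ### Negative drift: the weighted clearing distance has finite mean. -/

section Drift

lemma IsOverloaded.mono {c : ℕ} {x y : ℕ → ℝ} {k l : ℕ} (h : IsOverloaded c x y l) (hkl : k ≤ l) :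
    IsOverloaded c x y k := fun m hm => h m (hm.trans hkl)

lemma sum_range_blocks (y : ℕ → ℝ) (c n : ℕ) :
    ∑ k ∈ Finset.range n, ∑ l ∈ Finset.range c, y (c * k + l) =
      ∑ l ∈ Finset.range (c * n), y l := by
  induction n with
  | zero => simp
  | succ n ih => rw [Finset.sum_range_succ, ih, mul_add, mul_one, Finset.sum_range_add]

/-- The increment of the backlog between a server and its predecessor, with the time needed for the
arrival of `c` users truncated at `L`. -/
def truncatedDrift (c : ℕ) (L : ℝ) (z : ℕ ⊕ ℕ → ℝ) : ℝ :=
  min L (∑ l ∈ Finset.range c, z (Sum.inr l)) - z (Sum.inl 0)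

-- Overload persists only up to a first failure, so the sum is stopped there. At the last overloaded
-- index, the blocks of user gaps so far fit into the server gaps so far, which bounds all terms but
-- the last by `x 0`. The truncation bounds the last term, the overshoot, by `L` pathwise.
open Classical in
lemma sum_truncatedDrift_le {x y : ℕ → ℝ} (hx : ∀ n, 0 ≤ x n) (hy : ∀ n, 0 ≤ y n) {L : ℝ}
    (hL : 0 ≤ L) (c n : ℕ) :
    ∑ k ∈ Finset.range n, (if IsOverloaded c x y k then
      min L (∑ l ∈ Finset.range c, y (c * (k + 1) + l)) - x (k + 1) else 0) ≤ x 0 + L := by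
  induction n with
  | zero => simpa using add_nonneg (hx 0) hL
  | succ n ih =>
    by_cases ho : IsOverloaded c x y n
    · have h1 : ∀ k ∈ Finset.range (n + 1), (if IsOverloaded c x y k then
          min L (∑ l ∈ Finset.range c, y (c * (k + 1) + l)) - x (k + 1) else 0) =
          min L (∑ l ∈ Finset.range c, y (c * (k + 1) + l)) - x (k + 1) := fun k hk =>
        if_pos (ho.mono (Nat.lt_succ_iff.1 (Finset.mem_range.1 hk)))
      rw [Finset.sum_congr rfl h1, Finset.sum_range_succ, Finset.sum_sub_distrib]
      have h2 : ∑ k ∈ Finset.range n, min L (∑ l ∈ Finset.range c, y (c * (k + 1) + l)) ≤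
          ∑ k ∈ Finset.range n, ∑ l ∈ Finset.range c, y (c * (k + 1) + l) :=
        Finset.sum_le_sum fun k _ => min_le_right _ _
      have h3 := sum_range_blocks y c (n + 1)
      rw [Finset.sum_range_succ'] at h3
      have h4 : 0 ≤ ∑ l ∈ Finset.range c, y (c * 0 + l) := Finset.sum_nonneg fun _ _ => hy _
      have h5 := ho n le_rfl
      rw [Finset.sum_range_succ' x] at h5
      have h6 := min_le_left L (∑ l ∈ Finset.range c, y (c * (n + 1) + l))
      have h7 := hx (n + 1)
      linarith
    · rw [Finset.sum_range_succ, if_neg ho, add_zero]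
      exact ih

lemma measurable_truncatedDrift (c : ℕ) (L : ℝ) : Measurable (truncatedDrift c L) := by
  unfold truncatedDrift
  fun_prop

lemma measurableSet_isOverloaded (c k : ℕ) :
    MeasurableSet {z : ℕ ⊕ ℕ → ℝ | IsOverloaded c (fun l => z (Sum.inl l))
      (fun l => z (Sum.inr l)) k} := by
  have : {z : ℕ ⊕ ℕ → ℝ | IsOverloaded c (fun l => z (Sum.inl l)) (fun l => z (Sum.inr l)) k} =
      ⋂ m, ⋂ (_ : m ≤ k), {z : ℕ ⊕ ℕ → ℝ | ∑ l ∈ Finset.range (c * (m + 1)), z (Sum.inr l) ≤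
        ∑ l ∈ Finset.range (m + 1), z (Sum.inl l)} := by
    ext z; simp [IsOverloaded]
  rw [this]
  exact MeasurableSet.iInter fun m => MeasurableSet.iInter fun _ =>
    measurableSet_le (by fun_prop) (by fun_prop)

/-- The clearing distance as a function of the joint path of servers and users. -/
noncomputable def pathClearing (c : ℕ) (z : ℕ ⊕ ℕ → ℝ) : ENNReal :=
  clearingDistance c (fun l => z (Sum.inl l)) fun l => z (Sum.inr l)

lemma measurable_pathClearing (c : ℕ) : Measurable (pathClearing c) := by
  unfold pathClearing clearingDistance
  refine Measurable.add (f := fun z : ℕ ⊕ ℕ → ℝ => ENNReal.ofReal (z (Sum.inl 0))) (by fun_prop)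
    (Measurable.tsum fun k => ?_)
  exact Measurable.ite (measurableSet_isOverloaded c k) (by fun_prop) measurable_const

open Classical in
/-- The indicator of overload weighted with the first gap. -/
noncomputable def overloadWeight (c k : ℕ) (z : ℕ ⊕ ℕ → ℝ) : ℝ :=
  if IsOverloaded c (fun l => z (Sum.inl l)) (fun l => z (Sum.inr l)) k then 1 + z (Sum.inl 0)
  else 0

lemma measurable_overloadWeight (c k : ℕ) : Measurable (overloadWeight c k) :=
  Measurable.ite (measurableSet_isOverloaded c k) (by fun_prop) measurable_const

/-- The gaps of the first `a` servers and the first `b` users. -/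
def pastIndices (a b : ℕ) : Set (ℕ ⊕ ℕ) :=
  {q | Sum.elim (fun j => j < a) (fun i => i < b) q}

/-- This is the stopping-time property: overload at `k` is decided before the server gap `k + 1` and
the user block that enter the next drift term. -/
lemma dependsOn_overloadWeight (c k : ℕ) :
    DependsOn (overloadWeight c k) (pastIndices (k + 1) (c * (k + 1))) := by
  intro z z' hz
  have hX : ∀ j < k + 1, z (Sum.inl j) = z' (Sum.inl j) := fun j hj => hz _ hj
  have hY : ∀ i < c * (k + 1), z (Sum.inr i) = z' (Sum.inr i) := fun i hi => hz _ hi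
  have h1 : IsOverloaded c (fun l => z (Sum.inl l)) (fun l => z (Sum.inr l)) k ↔
      IsOverloaded c (fun l => z' (Sum.inl l)) (fun l => z' (Sum.inr l)) k := by
    unfold IsOverloaded
    refine forall₂_congr fun m hm => ?_
    rw [Finset.sum_congr rfl fun l hl => hX l (by have := Finset.mem_range.1 hl; omega),
      Finset.sum_congr rfl fun l hl => hY l ((Finset.mem_range.1 hl).trans_le
        (Nat.mul_le_mul_left c (by omega)))]
  unfold overloadWeight
  rw [hX 0 (Nat.succ_pos _)]
  by_cases ho : IsOverloaded c (fun l => z (Sum.inl l)) (fun l => z (Sum.inr l)) k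
  · rw [if_pos ho, if_pos (h1.1 ho)]
  · rw [if_neg ho, if_neg (mt h1.2 ho)]

lemma dependsOn_comp_shift {β : Type*} (g : (ℕ ⊕ ℕ → ℝ) → β) (a b : ℕ) :
    DependsOn (fun z : ℕ ⊕ ℕ → ℝ => g fun q => z (Sum.map (a + ·) (b + ·) q))
      (pastIndices a b)ᶜ := by
  intro z z' hz
  refine congrArg g (funext fun q => hz _ ?_)
  rcases q with j | i
  · simp only [pastIndices, Set.mem_compl_iff, Set.mem_ofPred_eq, Sum.map_inl, Sum.elim_inl]
    omega
  · simp only [pastIndices, Set.mem_compl_iff, Set.mem_ofPred_eq, Sum.map_inr, Sum.elim_inr]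
    omega

namespace IsRenewalPair

variable {Ω : Type*} [MeasurableSpace Ω] {P : Measure Ω} {F : ℕ ⊕ ℕ → Ω → ℝ}

/-- The past of the two renewal processes is independent of their future. -/
lemma indepFun_shiftedPath (h : IsRenewalPair P F) {β γ : Type*} [MeasurableSpace β]
    [MeasurableSpace γ] {f : (ℕ ⊕ ℕ → ℝ) → β} {g : (ℕ ⊕ ℕ → ℝ) → γ} (hf : Measurable f)
    (hg : Measurable g) {a b : ℕ} (hfd : DependsOn f (pastIndices a b)) :
    IndepFun (fun ω => f fun q => F q ω) (fun ω => g (shiftedPath F a b ω)) P :=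
  iIndepFun.indepFun_of_dependsOn h.measurable h.indep hf
    (g := fun z => g fun q => z (Sum.map (a + ·) (b + ·) q))
    (hg.comp (measurable_pi_iff.2 fun _ => measurable_pi_apply _)) disjoint_compl_right
    hfd (dependsOn_comp_shift g a b)

variable [IsProbabilityMeasure P]

/-- The truncated block means tend to `c` times the mean user gap, which exceeds the mean server
gap. -/
lemma exists_truncation (h : IsRenewalPair P F) {c : ℕ}
    (hload : ∫ ω, F (Sum.inl 0) ω ∂P < c * ∫ ω, F (Sum.inr 0) ω ∂P) :
    ∃ L : ℝ, 0 ≤ L ∧ 0 < ∫ ω, truncatedDrift c L (fun q => F q ω) ∂P := by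
  have hint : ∀ L : ℕ, Integrable (fun ω => min (L : ℝ) (∑ l ∈ Finset.range c, F (Sum.inr l) ω)) P :=
    fun L => (integrable_const _).inf (integrable_finsetSum _ fun l _ => h.integrable_inr l)
  have hsum : Integrable (fun ω => ∑ l ∈ Finset.range c, F (Sum.inr l) ω) P :=
    integrable_finsetSum _ fun l _ => h.integrable_inr l
  have hlim : Tendsto (fun L : ℕ => ∫ ω, min (L : ℝ) (∑ l ∈ Finset.range c, F (Sum.inr l) ω) ∂P)
      atTop (𝓝 (∫ ω, ∑ l ∈ Finset.range c, F (Sum.inr l) ω ∂P)) := by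
    refine tendsto_integral_of_dominated_convergence _ (fun L => (hint L).aestronglyMeasurable)
      hsum (fun L => ?_) (Eventually.of_forall fun ω => ?_)
    · filter_upwards [h.nonneg] with ω hω
      have h0 : 0 ≤ ∑ l ∈ Finset.range c, F (Sum.inr l) ω := Finset.sum_nonneg fun l _ => hω _
      rw [Real.norm_eq_abs, abs_of_nonneg (le_min (Nat.cast_nonneg L) h0)]
      exact min_le_right _ _
    · refine tendsto_const_nhds.congr' ?_
      filter_upwards [tendsto_natCast_atTop_atTop.eventually_ge_atTop
        (∑ l ∈ Finset.range c, F (Sum.inr l) ω)] with L hL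
      exact (min_eq_right hL).symm
  have hval : ∫ ω, ∑ l ∈ Finset.range c, F (Sum.inr l) ω ∂P = c * ∫ ω, F (Sum.inr 0) ω ∂P := by
    rw [integral_finsetSum _ fun l _ => h.integrable_inr l,
      Finset.sum_congr rfl fun l _ => (h.identDistrib_inr l).integral_eq]
    simp
  rw [hval] at hlim
  obtain ⟨L, hL⟩ := (hlim.eventually_const_lt hload).exists
  refine ⟨L, Nat.cast_nonneg L, ?_⟩
  unfold truncatedDrift
  rw [integral_sub (hint L) (h.integrable_inl 0)]
  linarith

lemma integrable_truncatedDrift (h : IsRenewalPair P F) (c : ℕ) (L : ℝ) :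
    Integrable (fun ω => truncatedDrift c L fun q => F q ω) P :=
  ((integrable_const _).inf (integrable_finsetSum _ fun l _ => h.integrable_inr l)).sub
    (h.integrable_inl 0)

lemma integrable_overloadWeight (h : IsRenewalPair P F) (c k : ℕ) :
    Integrable (fun ω => overloadWeight c k fun q => F q ω) P := by
  refine ((integrable_const 1).add (h.integrable_inl 0)).mono'
    ((measurable_overloadWeight c k).comp h.measurable_path).aestronglyMeasurable ?_
  filter_upwards [h.nonneg] with ω hω
  have := hω (Sum.inl 0)
  unfold overloadWeight
  simp only [Pi.add_apply, Real.norm_eq_abs]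
  split_ifs
  · rw [abs_of_nonneg (by linarith)]
  · rw [abs_zero]; linarith

lemma overloadWeight_nonneg {z : ℕ ⊕ ℕ → ℝ} (hz : ∀ q, 0 ≤ z q) (c k : ℕ) :
    0 ≤ overloadWeight c k z := by
  unfold overloadWeight
  split_ifs
  · linarith [hz (Sum.inl 0)]
  · exact le_rfl

/-- Wald's argument: each drift term is independent of the preceding overload weight and has mean `δ
> 0`, so `δ` times the sum is the mean of a stopped sum. By `sum_truncatedDrift_le` the latter is at
most the mean of `(1 + X₀) * (X₀ + L)`, finite because `X₀` has a second moment. -/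
lemma exists_sum_integral_overloadWeight_le (h : IsRenewalPair P F) {c : ℕ}
    (hload : ∫ ω, F (Sum.inl 0) ω ∂P < c * ∫ ω, F (Sum.inr 0) ω ∂P) :
    ∃ M : ℝ, ∀ n, ∑ k ∈ Finset.range n, ∫ ω, overloadWeight c k (fun q => F q ω) ∂P ≤ M := by
  classical
  obtain ⟨L, hL, hδ⟩ := h.exists_truncation hload
  set δ := ∫ ω, truncatedDrift c L (fun q => F q ω) ∂P
  refine ⟨(∫ ω, (1 + F (Sum.inl 0) ω) * (F (Sum.inl 0) ω + L) ∂P) / δ, fun n => ?_⟩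
  rw [le_div_iff₀ hδ, Finset.sum_mul]
  have hdrift : ∀ k, IdentDistrib
      (fun ω => truncatedDrift c L (shiftedPath F (k + 1) (c * (k + 1)) ω))
      (fun ω => truncatedDrift c L fun q => F q ω) P P := fun k =>
    (h.identDistrib_shiftedPath _ _).comp (measurable_truncatedDrift c L)
  have hind := fun k => h.indepFun_shiftedPath (measurable_overloadWeight c k)
    (measurable_truncatedDrift c L) (dependsOn_overloadWeight c k)
  have hprod : ∀ k, Integrable (fun ω => overloadWeight c k (fun q => F q ω) *
      truncatedDrift c L (shiftedPath F (k + 1) (c * (k + 1)) ω)) P := fun k =>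
    (hind k).integrable_mul (h.integrable_overloadWeight c k)
      ((hdrift k).integrable_iff.2 (h.integrable_truncatedDrift c L))
  have hmul : ∀ k, (∫ ω, overloadWeight c k (fun q => F q ω) ∂P) * δ =
      ∫ ω, overloadWeight c k (fun q => F q ω) *
        truncatedDrift c L (shiftedPath F (k + 1) (c * (k + 1)) ω) ∂P := by
    intro k
    rw [(hind k).integral_fun_mul_eq_mul_integral
      (h.integrable_overloadWeight c k).aestronglyMeasurable
      ((hdrift k).integrable_iff.2 (h.integrable_truncatedDrift c L)).aestronglyMeasurable,
      (hdrift k).integral_eq]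
  rw [Finset.sum_congr rfl fun k _ => hmul k, ← integral_finsetSum _ fun k _ => hprod k]
  refine integral_mono_ae (integrable_finsetSum _ fun k _ => hprod k) ?_ ?_
  · have h1 := h.memLp_const_add 1
    have h2 := h.memLp_const_add L
    refine (h1.integrable_mul h2).congr (Eventually.of_forall fun ω => ?_)
    simp only [Pi.mul_apply]
    ring
  · filter_upwards [h.nonneg] with ω hω
    have h1 := sum_truncatedDrift_le (x := fun l => F (Sum.inl l) ω) (y := fun l => F (Sum.inr l) ω)
      (fun _ => hω _) (fun _ => hω _) hL c n
    have h2 : (0 : ℝ) ≤ 1 + F (Sum.inl 0) ω := by linarith [hω (Sum.inl 0)]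
    refine le_trans (le_of_eq ?_) (mul_le_mul_of_nonneg_left h1 h2)
    rw [Finset.mul_sum]
    refine Finset.sum_congr rfl fun k _ => ?_
    simp only [overloadWeight, truncatedDrift, shiftedPath, Sum.map_inl, Sum.map_inr, add_zero]
    split_ifs <;> simp

/-- The clearing distance has a finite expectation, even when weighted with the first gap. -/
lemma lintegral_pathClearing_lt_top (h : IsRenewalPair P F) {c : ℕ}
    (hload : ∫ ω, F (Sum.inl 0) ω ∂P < c * ∫ ω, F (Sum.inr 0) ω ∂P) :
    ∫⁻ ω, ENNReal.ofReal (1 + F (Sum.inl 0) ω) * pathClearing c (fun q => F q ω) ∂P < ⊤ := by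
  classical
  obtain ⟨M, hM⟩ := h.exists_sum_integral_overloadWeight_le hload
  set a := ∫ ω, F (Sum.inl 0) ω ∂P with ha
  have ha0 : 0 ≤ a := integral_nonneg_of_ae (h.nonneg.mono fun ω hω => hω _)
  -- The gap `k + 1` is independent of overload at `k`, so each term of the series factors.
  have hterm : ∀ k, ∫⁻ ω, ENNReal.ofReal (overloadWeight c k fun q => F q ω) *
      ENNReal.ofReal (F (Sum.inl (k + 1)) ω) ∂P =
      ENNReal.ofReal ((∫ ω, overloadWeight c k (fun q => F q ω) ∂P) * a) := by
    intro k
    have hind := h.indepFun_shiftedPath (measurable_overloadWeight c k)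
      (g := fun z => z (Sum.inl 0)) (by fun_prop) (dependsOn_overloadWeight c k)
    have hX : (fun ω => shiftedPath F (k + 1) (c * (k + 1)) ω (Sum.inl 0)) =
        F (Sum.inl (k + 1)) := by
      funext ω; simp [shiftedPath]
    rw [hX] at hind
    rw [ha, ← (h.identDistrib_inl (k + 1)).integral_eq,
      ← hind.integral_fun_mul_eq_mul_integral
        (h.integrable_overloadWeight c k).aestronglyMeasurable
        (h.integrable_inl _).aestronglyMeasurable, ofReal_integral_eq_lintegral_ofReal]
    · refine lintegral_congr_ae (h.nonneg.mono fun ω hω => ?_)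
      exact (ENNReal.ofReal_mul (overloadWeight_nonneg hω c k)).symm
    · exact hind.integrable_mul (h.integrable_overloadWeight c k) (h.integrable_inl _)
    · exact h.nonneg.mono fun ω hω => mul_nonneg (overloadWeight_nonneg hω c k) (hω _)
  have hsplit : ∀ ω, ENNReal.ofReal (1 + F (Sum.inl 0) ω) * pathClearing c (fun q => F q ω) =
      ENNReal.ofReal (1 + F (Sum.inl 0) ω) * ENNReal.ofReal (F (Sum.inl 0) ω) +
      ∑' k, ENNReal.ofReal (overloadWeight c k fun q => F q ω) *
        ENNReal.ofReal (F (Sum.inl (k + 1)) ω) := by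
    intro ω
    unfold pathClearing clearingDistance overloadWeight
    rw [mul_add, ← ENNReal.tsum_mul_left]
    congr 2
    funext k
    split_ifs <;> simp
  have hX := h.measurable
  have hW := fun k => (measurable_overloadWeight c k).comp h.measurable_path
  simp_rw [hsplit]
  rw [lintegral_add_left (by fun_prop), lintegral_tsum (f := fun k ω =>
    ENNReal.ofReal (overloadWeight c k fun q => F q ω) * ENNReal.ofReal (F (Sum.inl (k + 1)) ω))
    fun k => ((hW k).ennreal_ofReal.mul (hX _).ennreal_ofReal).aemeasurable]
  refine ENNReal.add_lt_top.2 ⟨?_, ?_⟩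
  · have h1 := h.memLp_const_add 1
    have h2 := (h1.integrable_mul h.memLp).lintegral_lt_top
    refine lt_of_le_of_lt (lintegral_mono_ae (h.nonneg.mono fun ω hω => ?_)) h2
    rw [Pi.mul_apply, ENNReal.ofReal_mul (by linarith [hω (Sum.inl 0)])]
  · refine lt_of_le_of_lt (ENNReal.tsum_le_of_sum_range_le fun n => ?_)
      (ENNReal.ofReal_lt_top (r := M * a))
    rw [Finset.sum_congr rfl fun k _ => hterm k, ← ENNReal.ofReal_sum_of_nonneg, ← Finset.sum_mul]
    · exact ENNReal.ofReal_le_ofReal (mul_le_mul_of_nonneg_right (hM n) ha0)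
    · intro k _
      exact mul_nonneg (integral_nonneg_of_ae (h.nonneg.mono fun ω hω =>
        overloadWeight_nonneg hω c k)) ha0

end IsRenewalPair

end Drift

/-! ### Renewal estimate for the gap in which a user lands. -/

section Renewal

lemma measurableSet_between {α : Type*} [MeasurableSpace α] {f g h : α → ℝ} (hf : Measurable f)
    (hg : Measurable g) (hh : Measurable h) : MeasurableSet {a | f a ≤ g a ∧ g a ≤ h a} :=
  (measurableSet_le hf hg).inter (measurableSet_le hg hh)

namespace IsRenewalPair

variable {Ω : Type*} [MeasurableSpace Ω] {P : Measure Ω} {F : ℕ ⊕ ℕ → Ω → ℝ}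

lemma exists_gap_gt (h0 : 0 < ∫ ω, F (Sum.inl 0) ω ∂P) :
    ∃ δ : ℝ, 0 < δ ∧ 0 < P {ω | δ < F (Sum.inl 0) ω} := by
  by_contra! hcon
  have h1 : ∀ n : ℕ, ∀ᵐ ω ∂P, F (Sum.inl 0) ω ≤ 1 / ((n : ℝ) + 1) := by
    intro n
    have := nonpos_iff_eq_zero.1 (hcon (1 / ((n : ℝ) + 1)) (by positivity))
    rw [ae_iff]
    simpa only [not_le] using this
  have h2 : ∀ᵐ ω ∂P, F (Sum.inl 0) ω ≤ 0 := by
    filter_upwards [ae_all_iff.2 h1] with ω hω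
    exact ge_of_tendsto' tendsto_one_div_add_atTop_nhds_zero_nat hω
  linarith [integral_nonpos_of_ae h2]

/-- The location of user `i` together with the point reached by the first `j` servers. -/
def userAndServer (i j : ℕ) (z : ℕ ⊕ ℕ → ℝ) : ℝ × ℝ :=
  (∑ k ∈ Finset.range (i + 1), z (Sum.inr k), ∑ k ∈ Finset.range j, z (Sum.inl k))

lemma measurable_userAndServer (i j : ℕ) : Measurable (userAndServer i j) := by
  unfold userAndServer
  fun_prop

lemma dependsOn_userAndServer (i j : ℕ) :
    DependsOn (userAndServer i j) (pastIndices j (i + 1)) := by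
  intro z z' hz
  unfold userAndServer
  rw [Finset.sum_congr rfl fun k hk => hz (Sum.inr k) (Finset.mem_range.1 hk),
    Finset.sum_congr rfl fun k hk => hz (Sum.inl k) (Finset.mem_range.1 hk)]

variable [IsProbabilityMeasure P]

/-- The expected number of servers in an interval of length `δ`, relative to a user, is bounded. -/
lemma tsum_measure_mul_le_one (h : IsRenewalPair P F) (i : ℕ) (a δ : ℝ) :
    (∑' j, P {ω | ∑ k ∈ Finset.range (i + 1), F (Sum.inr k) ω + a ≤
        ∑ k ∈ Finset.range j, F (Sum.inl k) ω ∧ ∑ k ∈ Finset.range j, F (Sum.inl k) ω ≤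
          ∑ k ∈ Finset.range (i + 1), F (Sum.inr k) ω + a + δ}) *
      P {ω | δ < F (Sum.inl 0) ω} ≤ 1 := by
  set R : Ω → ℝ := fun ω => ∑ k ∈ Finset.range (i + 1), F (Sum.inr k) ω with hR
  set S : ℕ → Ω → ℝ := fun j ω => ∑ k ∈ Finset.range j, F (Sum.inl k) ω with hS
  have hm := h.measurable
  have hRm : Measurable R := by fun_prop
  have hSm : ∀ j, Measurable (S j) := fun j => by fun_prop
  set A : ℕ → Set Ω := fun j => {ω | R ω + a ≤ S j ω ∧ S j ω ≤ R ω + a + δ} with hA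
  set B : ℕ → Set Ω := fun j => {ω | δ < F (Sum.inl j) ω} with hB
  have hAm : ∀ j, MeasurableSet (A j) := fun j =>
    measurableSet_between (by fun_prop) (hSm j) (by fun_prop)
  have hBm : ∀ j, MeasurableSet (B j) := fun j => measurableSet_lt measurable_const (hm _)
  have hmul : ∀ j, P (A j) * P (B 0) = P (A j ∩ B j) := by
    intro j
    have hind := h.indepFun_shiftedPath (measurable_userAndServer i j)
      (g := fun z => z (Sum.inl 0)) (by fun_prop) (dependsOn_userAndServer i j)
    have hBj : P (B 0) = P (B j) :=
      ((h.identDistrib_inl j).measure_mem_eq (measurableSet_Ioi (a := δ))).symm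
    have hU : MeasurableSet {p : ℝ × ℝ | p.1 + a ≤ p.2 ∧ p.2 ≤ p.1 + a + δ} :=
      measurableSet_between (by fun_prop) (by fun_prop) (by fun_prop)
    have := hind.measure_inter_preimage_eq_mul _ _ hU (measurableSet_Ioi (a := δ))
    rw [hBj]
    simpa [userAndServer, shiftedPath, Set.preimage, hA, hB] using this.symm
  -- A gap longer than `δ` leaps out of the window, so only the last partial sum in the window can
  -- be followed by one.
  have hdisj : Pairwise (Function.onFun (AEDisjoint P) fun j => A j ∩ B j) := by
    have key : ∀ j l, j < l → AEDisjoint P (A j ∩ B j) (A l ∩ B l) := by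
      intro j l hjl
      refine measure_mono_null (fun ω hω => ?_) (ae_iff.1 h.nonneg)
      intro hpos
      have h1 : S (j + 1) ω ≤ S l ω :=
        Finset.sum_le_sum_of_subset_of_nonneg (Finset.range_mono hjl) fun _ _ _ => hpos _
      have h2 : S (j + 1) ω = S j ω + F (Sum.inl j) ω := Finset.sum_range_succ _ _
      have h3 := hω.1.1.1
      have h4 : δ < F (Sum.inl j) ω := hω.1.2
      have h5 := hω.2.1.2
      linarith
    intro j l hjl
    rcases lt_or_gt_of_ne hjl with h1 | h1
    · exact key j l h1
    · exact (key l j h1).symm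
  calc (∑' j, P (A j)) * P (B 0) = ∑' j, P (A j ∩ B j) := by
        rw [← ENNReal.tsum_mul_right]
        exact tsum_congr hmul
    _ ≤ P Set.univ := tsum_measure_le_measure_univ
        (fun j => ((hAm j).inter (hBm j)).nullMeasurableSet) hdisj
    _ = 1 := measure_univ

/-- The expected number of servers in an interval to the left of a user grows at most linearly with
the length of the interval. -/
lemma exists_renewal_bound (h : IsRenewalPair P F) (h0 : 0 < ∫ ω, F (Sum.inl 0) ω ∂P) :
    ∃ C : ENNReal, C ≠ ⊤ ∧ ∀ (i : ℕ) (x : ℝ), 0 ≤ x →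
      ∑' j, P {ω | ∑ k ∈ Finset.range (i + 1), F (Sum.inr k) ω - x ≤
        ∑ k ∈ Finset.range j, F (Sum.inl k) ω ∧ ∑ k ∈ Finset.range j, F (Sum.inl k) ω ≤
          ∑ k ∈ Finset.range (i + 1), F (Sum.inr k) ω} ≤ C * ENNReal.ofReal (1 + x) := by
  obtain ⟨δ, hδ, hp⟩ := exists_gap_gt h0
  set p := P {ω | δ < F (Sum.inl 0) ω}
  -- The interval is covered by `⌊x / δ⌋ + 1 ≤ (1 / δ + 1) * (1 + x)` windows of length `δ`, each
  -- contributing at most `1 / p`.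
  refine ⟨ENNReal.ofReal (1 / δ + 1) / p, ENNReal.div_ne_top ENNReal.ofReal_ne_top hp.ne', ?_⟩
  intro i x hx
  set R : Ω → ℝ := fun ω => ∑ k ∈ Finset.range (i + 1), F (Sum.inr k) ω with hR
  set S : ℕ → Ω → ℝ := fun j ω => ∑ k ∈ Finset.range j, F (Sum.inl k) ω with hS
  set N := ⌊x / δ⌋₊ + 1 with hN
  have hcover : ∀ j, P {ω | R ω - x ≤ S j ω ∧ S j ω ≤ R ω} ≤ ∑ m ∈ Finset.range N,
      P {ω | R ω + (-x + m * δ) ≤ S j ω ∧ S j ω ≤ R ω + (-x + m * δ) + δ} := by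
    intro j
    refine (measure_mono fun ω hω => ?_).trans (measure_biUnion_finset_le _ _)
    obtain ⟨h1, h2⟩ := hω
    simp only [Set.mem_iUnion, Finset.mem_range]
    have hq : 0 ≤ (S j ω - (R ω - x)) / δ := div_nonneg (by linarith) hδ.le
    refine ⟨⌊(S j ω - (R ω - x)) / δ⌋₊, ?_, ?_, ?_⟩
    · refine Nat.lt_succ_of_le (Nat.floor_le_floor (div_le_div_of_nonneg_right ?_ hδ.le))
      linarith
    · have := Nat.floor_le hq
      rw [le_div_iff₀ hδ] at this
      linarith
    · have := Nat.lt_floor_add_one ((S j ω - (R ω - x)) / δ)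
      rw [div_lt_iff₀ hδ] at this
      linarith
  calc ∑' j, P {ω | R ω - x ≤ S j ω ∧ S j ω ≤ R ω}
      ≤ ∑' j, ∑ m ∈ Finset.range N,
        P {ω | R ω + (-x + m * δ) ≤ S j ω ∧ S j ω ≤ R ω + (-x + m * δ) + δ} :=
        ENNReal.tsum_le_tsum hcover
    _ = ∑ m ∈ Finset.range N, ∑' j,
        P {ω | R ω + (-x + m * δ) ≤ S j ω ∧ S j ω ≤ R ω + (-x + m * δ) + δ} :=
        Summable.tsum_finsetSum fun _ _ => ENNReal.summable
    _ ≤ ∑ m ∈ Finset.range N, 1 / p := Finset.sum_le_sum fun m _ => by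
        rw [ENNReal.le_div_iff_mul_le (Or.inl hp.ne') (Or.inl (measure_ne_top _ _))]
        exact h.tsum_measure_mul_le_one i _ δ
    _ = ENNReal.ofReal N * (1 / p) := by
        rw [Finset.sum_const, Finset.card_range, nsmul_eq_mul, ENNReal.ofReal_natCast]
    _ ≤ ENNReal.ofReal ((1 / δ + 1) * (1 + x)) * (1 / p) := by
        gcongr
        have h1 := Nat.floor_le (div_nonneg hx hδ.le)
        have h2 : (N : ℝ) = ⌊x / δ⌋₊ + 1 := by rw [hN]; push_cast; rfl
        have h3 : (0 : ℝ) < 1 / δ := by positivity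
        have h4 : x / δ = 1 / δ * x := by ring
        rw [h2]
        nlinarith
    _ = _ := by
        rw [ENNReal.ofReal_mul (by positivity)]
        simp only [div_eq_mul_inv, one_mul]
        ring

/-- Summing a functional of the future over the servers whose preceding gap contains a user costs
at most a weight linear in that gap. -/
lemma exists_tsum_lintegral_le (h : IsRenewalPair P F) (h0 : 0 < ∫ ω, F (Sum.inl 0) ω ∂P) :
    ∃ C : ENNReal, C ≠ ⊤ ∧ ∀ (i : ℕ) (Ψ : (ℕ ⊕ ℕ → ℝ) → ENNReal), Measurable Ψ →
      ∑' j, ∫⁻ ω, {ω | ∑ k ∈ Finset.range (i + 1), F (Sum.inr k) ω - F (Sum.inl j) ω ≤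
        ∑ k ∈ Finset.range j, F (Sum.inl k) ω ∧ ∑ k ∈ Finset.range j, F (Sum.inl k) ω ≤
          ∑ k ∈ Finset.range (i + 1), F (Sum.inr k) ω}.indicator
            (fun ω => Ψ (shiftedPath F j (i + 1) ω)) ω ∂P ≤
      C * ∫⁻ ω, ENNReal.ofReal (1 + F (Sum.inl 0) ω) * Ψ (fun q => F q ω) ∂P := by
  obtain ⟨C, hC, hbound⟩ := h.exists_renewal_bound h0
  refine ⟨C, hC, fun i Ψ hΨ => ?_⟩
  have hm := h.measurable
  set R : Ω → ℝ := fun ω => ∑ k ∈ Finset.range (i + 1), F (Sum.inr k) ω with hR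
  set S : ℕ → Ω → ℝ := fun j ω => ∑ k ∈ Finset.range j, F (Sum.inl k) ω with hS
  have hRm : Measurable R := by fun_prop
  have hSm : ∀ j, Measurable (S j) := fun j => by fun_prop
  set B : Set ((ℝ × ℝ) × (ℕ ⊕ ℕ → ℝ)) :=
    {p | p.1.1 - p.2 (Sum.inl 0) ≤ p.1.2 ∧ p.1.2 ≤ p.1.1} with hB
  have hBm : MeasurableSet B :=
    measurableSet_between (by fun_prop) (by fun_prop) (by fun_prop)
  set G : (ℝ × ℝ) × (ℕ ⊕ ℕ → ℝ) → ENNReal := B.indicator fun p => Ψ p.2 with hG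
  have hGm : Measurable G := (hΨ.comp measurable_snd).indicator hBm
  set Q := P.map fun ω q => F q ω with hQ
  have hQp : IsProbabilityMeasure Q := Measure.isProbabilityMeasure_map h.measurable_path.aemeasurable
  -- The position of user `i` and the `j`-th partial sum are independent of the shifted path, whose
  -- first server gap is gap `j`. Freezing that path `z` by Fubini leaves the probability that the
  -- partial sum falls within `z (Sum.inl 0)` to the left of the user. Summed over `j`, the renewal
  -- bound applies with this length.
  have hterm : ∀ j, ∫⁻ ω, {ω | R ω - F (Sum.inl j) ω ≤ S j ω ∧ S j ω ≤ R ω}.indicator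
      (fun ω => Ψ (shiftedPath F j (i + 1) ω)) ω ∂P =
      ∫⁻ z, Ψ z * P {ω | R ω - z (Sum.inl 0) ≤ S j ω ∧ S j ω ≤ R ω} ∂Q := by
    intro j
    have hUm := (measurable_userAndServer i j).comp h.measurable_path
    have hind := h.indepFun_shiftedPath (measurable_userAndServer i j)
      (g := fun z => z) measurable_id (dependsOn_userAndServer i j)
    have hmap := (indepFun_iff_map_prod_eq_prod_map_map hUm.aemeasurable
      (h.measurable_shiftedPath j (i + 1)).aemeasurable).1 hind
    rw [h.map_shiftedPath, ← hQ] at hmap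
    have h1 : ∀ ω, {ω | R ω - F (Sum.inl j) ω ≤ S j ω ∧ S j ω ≤ R ω}.indicator
        (fun ω => Ψ (shiftedPath F j (i + 1) ω)) ω =
        G (userAndServer i j (fun q => F q ω), shiftedPath F j (i + 1) ω) := by
      intro ω
      simp only [hG, hB, Set.indicator_apply, Set.mem_ofPred_eq, userAndServer, shiftedPath,
        Sum.map_inl, add_zero, hR, hS]
    simp_rw [h1]
    rw [← lintegral_map (f := G) (g := fun ω => (userAndServer i j (fun q => F q ω),
      shiftedPath F j (i + 1) ω)) hGm (hUm.prodMk (h.measurable_shiftedPath j (i + 1)))]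
    have hUp : IsProbabilityMeasure (P.map (userAndServer i j ∘ fun ω q => F q ω)) :=
      Measure.isProbabilityMeasure_map hUm.aemeasurable
    refine (congrArg (fun μ => ∫⁻ p, G p ∂μ) hmap).trans ?_
    rw [lintegral_prod_symm _ hGm.aemeasurable]
    refine lintegral_congr fun z => ?_
    rw [lintegral_map (f := fun u => G (u, z))
      (hGm.comp (measurable_id.prodMk measurable_const)) hUm]
    have hset : MeasurableSet {ω | R ω - z (Sum.inl 0) ≤ S j ω ∧ S j ω ≤ R ω} :=
      measurableSet_between (by fun_prop) (hSm j) hRm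
    rw [← setLIntegral_const, ← lintegral_indicator hset]
    refine lintegral_congr fun ω => ?_
    simp only [hG, hB, Set.indicator_apply, Set.mem_ofPred_eq, userAndServer, hR, hS,
      Function.comp_apply]
  have hmeasP : ∀ j, Measurable fun z : ℕ ⊕ ℕ → ℝ =>
      P {ω | R ω - z (Sum.inl 0) ≤ S j ω ∧ S j ω ≤ R ω} := by
    intro j
    have : MeasurableSet {p : (ℕ ⊕ ℕ → ℝ) × Ω |
        R p.2 - p.1 (Sum.inl 0) ≤ S j p.2 ∧ S j p.2 ≤ R p.2} :=
      measurableSet_between (by fun_prop) (by fun_prop) (by fun_prop)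
    exact measurable_measure_prodMk_left this
  rw [tsum_congr hterm, ← lintegral_tsum
    (f := fun j z => Ψ z * P {ω | R ω - z (Sum.inl 0) ≤ S j ω ∧ S j ω ≤ R ω})
    fun j => (hΨ.mul (hmeasP j)).aemeasurable]
  simp_rw [ENNReal.tsum_mul_left]
  have hrhs : C * ∫⁻ ω, ENNReal.ofReal (1 + F (Sum.inl 0) ω) * Ψ (fun q => F q ω) ∂P =
      ∫⁻ z, C * (ENNReal.ofReal (1 + z (Sum.inl 0)) * Ψ z) ∂Q := by
    rw [hQ, lintegral_map (by fun_prop) h.measurable_path, lintegral_const_mul]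
    have := hΨ.comp h.measurable_path
    exact Measurable.mul (by fun_prop) this
  rw [hrhs]
  refine lintegral_mono_ae ?_
  have hz : ∀ᵐ z ∂Q, 0 ≤ z (Sum.inl 0) := by
    rw [hQ, ae_map_iff h.measurable_path.aemeasurable
      (measurableSet_le measurable_const (measurable_pi_apply _))]
    exact h.nonneg.mono fun ω hω => hω _
  filter_upwards [hz] with z hz
  calc _ ≤ Ψ z * (C * ENNReal.ofReal (1 + z (Sum.inl 0))) := by
        gcongr
        exact hbound i _ hz
    _ = _ := by ring

end IsRenewalPair

end Renewal

/-! ### Measurability of the request distances. -/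

section Measurability

variable {Ω : Type*} [MeasurableSpace Ω]

/-- The complement is a countable union, over the `c`-element finite sets of indices, of finite
intersections. -/
lemma measurableSet_encard_lt {ι : Type*} [Countable ι] {A : ι → Set Ω}
    (hA : ∀ l, MeasurableSet (A l)) (c : ℕ) :
    MeasurableSet {ω | {l | ω ∈ A l}.encard < (c : ℕ∞)} := by
  have : {ω | {l | ω ∈ A l}.encard < (c : ℕ∞)} =
      (⋃ t : {t : Finset ι // t.card = c}, ⋂ l ∈ t.1, A l)ᶜ := by
    ext ω
    rw [Set.mem_compl_iff, Set.mem_ofPred_eq, ← not_le, not_iff_not]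
    simp only [Set.mem_iUnion, Set.mem_iInter]
    constructor
    · intro h
      obtain ⟨t, ht, htc⟩ := Set.exists_subset_encard_eq h
      have hfin := Set.finite_of_encard_eq_coe htc
      refine ⟨⟨hfin.toFinset, ?_⟩, fun l hl => ht (hfin.mem_toFinset.1 hl)⟩
      rw [hfin.encard_eq_coe_toFinset_card] at htc
      exact_mod_cast htc
    · rintro ⟨⟨t, rfl⟩, ht⟩
      rw [← Set.encard_coe_eq_coe_finsetCard]
      exact Set.encard_le_encard fun l hl => ht l hl
  rw [this]
  exact (MeasurableSet.iUnion fun t => Finset.measurableSet_biInter _ fun l _ => hA l).compl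

lemma measurable_requestDistance {r s : Ω → ℕ → ℝ} {server : Ω → ℕ → Option ℕ} {i : ℕ}
    (hr : Measurable fun ω => r ω i) (hs : ∀ j, Measurable fun ω => s ω j)
    (hserver : ∀ j, MeasurableSet {ω | server ω i = some j}) :
    Measurable fun ω => requestDistance (r ω) (s ω) (server ω) i := by
  classical
  -- At most one term of the series is nonzero.
  have : (fun ω => requestDistance (r ω) (s ω) (server ω) i) =
      fun ω => ∑' j, if server ω i = some j then s ω j - r ω i else 0 := by
    funext ω
    unfold requestDistance
    rcases hsv : server ω i with _ | j
    · simp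
    · simp
  rw [this]
  exact Measurable.tsum fun j => Measurable.ite (hserver j) ((hs j).sub hr) measurable_const

variable {r s : Ω → ℕ → ℝ} (hr : ∀ i, Measurable fun ω => r ω i)
  (hs : ∀ j, Measurable fun ω => s ω j)

include hr hs

lemma measurableSet_ugsUsers (c j : ℕ) (i : ℕ) :
    MeasurableSet {ω | i ∈ ugsUsers (r ω) (s ω) c j} := by
  induction j using Nat.strong_induction_on generalizing i with
  | _ j ih =>
    have harr : ∀ l, MeasurableSet {ω | l ∈ ugsArrivals (r ω) (s ω) c j} := by
      intro l
      have : {ω | l ∈ ugsArrivals (r ω) (s ω) c j} = {ω | r ω l ≤ s ω j} ∩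
          ⋂ k, ⋂ (_ : k < j), {ω | l ∈ ugsUsers (r ω) (s ω) c k}ᶜ := by
        ext ω; simp [ugsArrivals]
      rw [this]
      exact (measurableSet_le (hr l) (hs j)).inter
        (MeasurableSet.iInter fun k => MeasurableSet.iInter fun hk => (ih k hk l).compl)
    simp_rw [ugsUsers_eq]
    refine (harr i).inter (measurableSet_encard_lt
      (A := fun l => {ω | i < l ∧ l ∈ ugsArrivals (r ω) (s ω) c j}) (fun l => ?_) c)
    exact (MeasurableSet.const _).inter (harr l)

lemma measurableSet_mtrServer (c i j : ℕ) :
    MeasurableSet {ω | mtrServer (r ω) (s ω) c i = some j} := by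
  classical
  induction i using Nat.strong_induction_on generalizing j with
  | _ i ih =>
    have hadm : ∀ l, MeasurableSet {ω | r ω i ≤ s ω l ∧
        {k : Fin i | mtrServer (r ω) (s ω) c k = some l}.encard < (c : ℕ∞)} := fun l =>
      (measurableSet_le (hr i) (hs l)).inter (measurableSet_encard_lt
        (A := fun k : Fin i => {ω | mtrServer (r ω) (s ω) c k = some l}) (fun k => ih k k.2 l) c)
    have : {ω | mtrServer (r ω) (s ω) c i = some j} = {ω | r ω i ≤ s ω j ∧
        {k : Fin i | mtrServer (r ω) (s ω) c k = some j}.encard < (c : ℕ∞)} ∩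
        ⋂ l, ⋂ (_ : l < j), {ω | r ω i ≤ s ω l ∧
          {k : Fin i | mtrServer (r ω) (s ω) c k = some l}.encard < (c : ℕ∞)}ᶜ := by
      ext ω
      simp only [Set.mem_inter_iff, Set.mem_iInter, Set.mem_compl_iff]
      rw [Set.mem_ofPred_eq, mtrServer]
      split_ifs with h
      · rw [Option.some_inj, Nat.find_eq_iff]
        rfl
      · simp only [false_iff]
        exact fun h' => h ⟨j, h'.1⟩
    rw [this]
    exact (hadm j).inter (MeasurableSet.iInter fun l => MeasurableSet.iInter fun _ => (hadm l).compl)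

end Measurability

/-! ### Almost sure properties of the two policies. -/

namespace IsRenewalPair

variable {Ω : Type*} [MeasurableSpace Ω] {P : Measure Ω} {F : ℕ ⊕ ℕ → Ω → ℝ}

/-- The request distance of user `i` under unidirectional Gale-Shapley. -/
noncomputable def ugs (F : ℕ ⊕ ℕ → Ω → ℝ) (c i : ℕ) (ω : Ω) : ℝ :=
  ugsDistance (fun j => F (Sum.inl j) ω) (fun l => F (Sum.inr l) ω) c i

/-- The request distance of user `i` under Move To Right. -/
noncomputable def mtr (F : ℕ ⊕ ℕ → Ω → ℝ) (c i : ℕ) (ω : Ω) : ℝ :=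
  mtrDistance (fun j => F (Sum.inl j) ω) (fun l => F (Sum.inr l) ω) c i

/-- The location of user `i`. -/
noncomputable def userLocation (F : ℕ ⊕ ℕ → Ω → ℝ) (i : ℕ) (ω : Ω) : ℝ :=
  pointLocation (fun l => F (Sum.inr l) ω) i

lemma measurable_location (h : IsRenewalPair P F) (e : ℕ → ℕ ⊕ ℕ) (i : ℕ) :
    Measurable fun ω => pointLocation (fun l => F (e l) ω) i :=
  Finset.measurable_fun_sum _ fun _ _ => h.measurable _

lemma measurable_ugs (h : IsRenewalPair P F) (c i : ℕ) : Measurable (ugs F c i) :=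
  measurable_requestDistance (h.measurable_location Sum.inr i)
    (h.measurable_location Sum.inl) fun j => by
      simp_rw [ugsServer_eq_some_iff]
      exact measurableSet_ugsUsers (h.measurable_location Sum.inr) (h.measurable_location Sum.inl)
        c j i

lemma measurable_mtr (h : IsRenewalPair P F) (c i : ℕ) : Measurable (mtr F c i) :=
  measurable_requestDistance (h.measurable_location Sum.inr i)
    (h.measurable_location Sum.inl) fun j =>
      measurableSet_mtrServer (h.measurable_location Sum.inr) (h.measurable_location Sum.inl) c i j

lemma ae_tendsto_average (h : IsRenewalPair P F) [IsProbabilityMeasure P] :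
    ∀ᵐ ω ∂P, Tendsto (fun n : ℕ => (∑ k ∈ Finset.range n, F (Sum.inl k) ω) / n) atTop
        (𝓝 (∫ ω, F (Sum.inl 0) ω ∂P)) ∧
      Tendsto (fun n : ℕ => (∑ k ∈ Finset.range n, F (Sum.inr k) ω) / n) atTop
        (𝓝 (∫ ω, F (Sum.inr 0) ω ∂P)) :=
  (strong_law_ae_real (fun k => F (Sum.inl k)) (h.integrable_inl 0)
    (fun _ _ hij => h.indep.indepFun (Sum.inl_injective.ne hij)) h.identDistrib_inl).and
  (strong_law_ae_real (fun k => F (Sum.inr k)) (h.integrable_inr 0)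
    (fun _ _ hij => h.indep.indepFun (Sum.inr_injective.ne hij)) h.identDistrib_inr)

/-- Pathwise properties of the two allocations. -/
structure GoodPath (F : ℕ ⊕ ℕ → Ω → ℝ) (c : ℕ) (ω : Ω) : Prop where
  isSome_ugs : ∀ i, (ugsServer (pointLocation fun l => F (Sum.inr l) ω)
    (pointLocation fun j => F (Sum.inl j) ω) c i).isSome
  isSome_mtr : ∀ i, (mtrServer (pointLocation fun l => F (Sum.inr l) ω)
    (pointLocation fun j => F (Sum.inl j) ω) c i).isSome
  ugs_nonneg : ∀ i, 0 ≤ ugs F c i ω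
  mtr_nonneg : ∀ i, 0 ≤ mtr F c i ω
  tendsto_userLocation : Tendsto (fun i => userLocation F i ω) atTop atTop
  clearing : ∀ i, ∃ j, ∑ k ∈ Finset.range j, F (Sum.inl k) ω ≤ userLocation F i ω ∧
    userLocation F i ω ≤ ∑ k ∈ Finset.range (j + 1), F (Sum.inl k) ω ∧
    ENNReal.ofReal (ugs F c i ω) ≤ pathClearing c (shiftedPath F j (i + 1) ω)
  sum_mtr_le : ∀ (K : ℝ) (n : ℕ), ∑ i ∈ Finset.range n, max (mtr F c i ω - K) 0 ≤
    ∑ i ∈ Finset.range n, max (ugs F c i ω - K) 0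
  sum_ugs_le : ∀ n : ℕ, ∑ i ∈ Finset.range n, ugs F c i ω ≤ ∑ i ∈ Finset.range n, mtr F c i ω +
    ∑ i ∈ Finset.range n, max (ugs F c i ω - (userLocation F n ω - userLocation F i ω)) 0

lemma sum_ofReal_eq (f : ℕ → ℝ) (n : ℕ) : ∑ i ∈ Finset.range n, ENNReal.ofReal (f i) =
    ENNReal.ofReal (∑ i ∈ Finset.range n, max (f i) 0) := by
  rw [ENNReal.ofReal_sum_of_nonneg fun i _ => le_max_right _ _]
  refine Finset.sum_congr rfl fun i _ => ?_
  rw [ENNReal.ofReal_max]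
  simp

lemma ae_goodPath (h : IsRenewalPair P F) [IsProbabilityMeasure P] {c : ℕ}
    (hX0 : 0 < ∫ ω, F (Sum.inl 0) ω ∂P) (hY0 : 0 < ∫ ω, F (Sum.inr 0) ω ∂P)
    (hload : ∫ ω, F (Sum.inl 0) ω ∂P < c * ∫ ω, F (Sum.inr 0) ω ∂P) :
    ∀ᵐ ω ∂P, GoodPath F c ω := by
  have hc : 0 < c := by
    rcases Nat.eq_zero_or_pos c with h0 | h0
    · rw [h0, Nat.cast_zero, zero_mul] at hload; linarith
    · exact h0
  filter_upwards [h.nonneg, h.ae_tendsto_average] with ω hω hlim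
  set x : ℕ → ℝ := fun j => F (Sum.inl j) ω with hx
  set y : ℕ → ℝ := fun i => F (Sum.inr i) ω with hy
  have hx0 : ∀ j, 0 ≤ x j := fun j => hω _
  have hy0 : ∀ j, 0 ≤ y j := fun j => hω _
  have hr := monotone_pointLocation hy0
  have hs := monotone_pointLocation hx0
  have hr' := tendsto_pointLocation hY0 hlim.2
  have hs' := tendsto_pointLocation hX0 hlim.1
  obtain ⟨σ, hσ, hσW, hσc⟩ := exists_ugs hx0 hy0 hX0 hY0 hload hlim.1 hlim.2
  obtain ⟨τ, hτ, hτm, hτW⟩ := exists_mtr hc hr hs'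
  have hU : ∀ i, ugs F c i ω = pointLocation x (σ i) - pointLocation y i := by
    intro i
    unfold ugs ugsDistance requestDistance
    rw [hσ]
  have hM : ∀ i, mtr F c i ω = pointLocation x (τ i) - pointLocation y i := by
    intro i
    unfold mtr mtrDistance requestDistance
    rw [hτ]
  have hU0 : ∀ i, 0 ≤ ugs F c i ω := fun i => by rw [hU]; exact sub_nonneg.2 (hσW.le i)
  have hM0 : ∀ i, 0 ≤ mtr F c i ω := fun i => by rw [hM]; exact sub_nonneg.2 (hτW.le i)
  refine ⟨fun i => by rw [hσ]; rfl, fun i => by rw [hτ]; rfl, hU0, hM0, hr',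
    fun i => ?_, fun K n => ?_, fun n => ?_⟩
  · rw [hU]; exact hσc i
  · have h1 := hτW.sum_stopLoss_le hσW hr hs hs' hτm K n
    rw [sum_ofReal_eq, sum_ofReal_eq, ENNReal.ofReal_le_ofReal_iff
      (Finset.sum_nonneg fun _ _ => le_max_right _ _)] at h1
    simpa only [hU, hM, sub_sub] using h1
  · have h1 := hσW.sum_le_sum_add hτW hr hs hs' n
    rw [sum_ofReal_eq, sum_ofReal_eq, sum_ofReal_eq, ← ENNReal.ofReal_add
      (Finset.sum_nonneg fun _ _ => le_max_right _ _)
      (Finset.sum_nonneg fun _ _ => le_max_right _ _), ENNReal.ofReal_le_ofReal_iff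
      (add_nonneg (Finset.sum_nonneg fun _ _ => le_max_right _ _)
        (Finset.sum_nonneg fun _ _ => le_max_right _ _))] at h1
    simp_rw [← hU, ← hM] at h1
    rw [Finset.sum_congr rfl fun i _ => max_eq_left (hU0 i),
      Finset.sum_congr rfl fun i _ => max_eq_left (hM0 i)] at h1
    refine h1.trans (le_of_eq ?_)
    congr 1
    refine Finset.sum_congr rfl fun i _ => ?_
    rw [hU, show userLocation F n ω = pointLocation y n from rfl,
      show userLocation F i ω = pointLocation y i from rfl]
    congr 1
    ring

end IsRenewalPair

/-! ### Uniform integrability and means of steady-state laws. -/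

namespace IsRenewalPair

variable {Ω : Type*} [MeasurableSpace Ω] {P : Measure Ω} [IsProbabilityMeasure P]
  {F : ℕ ⊕ ℕ → Ω → ℝ}

/-- The request distances under unidirectional Gale-Shapley are uniformly integrable. -/
lemma exists_lintegral_ugs_le (h : IsRenewalPair P F) {c : ℕ}
    (hX0 : 0 < ∫ ω, F (Sum.inl 0) ω ∂P) (hY0 : 0 < ∫ ω, F (Sum.inr 0) ω ∂P)
    (hload : ∫ ω, F (Sum.inl 0) ω ∂P < c * ∫ ω, F (Sum.inr 0) ω ∂P) :
    ∃ H : ℕ → ENNReal, (∀ K, H K ≠ ⊤) ∧ Tendsto H atTop (𝓝 0) ∧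
      ∀ i (K : ℕ), ∫⁻ ω, ENNReal.ofReal (ugs F c i ω - K) ∂P ≤ H K := by
  obtain ⟨C, hC, hbound⟩ := h.exists_tsum_lintegral_le hX0
  have hm := h.measurable
  have hcm := measurable_pathClearing c
  have hcF : Measurable fun ω => pathClearing c fun q => F q ω := hcm.comp h.measurable_path
  have hfin := h.lintegral_pathClearing_lt_top hload
  set J : ℕ → ENNReal := fun K =>
    ∫⁻ ω, ENNReal.ofReal (1 + F (Sum.inl 0) ω) * (pathClearing c (fun q => F q ω) - K) ∂P with hJ
  have hJle : ∀ K, J K < ⊤ := fun K =>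
    lt_of_le_of_lt (lintegral_mono fun ω => by gcongr; exact tsub_le_self) hfin
  have hJlim : Tendsto J atTop (𝓝 0) := by
    have hae : ∀ᵐ ω ∂P, ENNReal.ofReal (1 + F (Sum.inl 0) ω) *
        pathClearing c (fun q => F q ω) < ⊤ :=
      ae_lt_top (Measurable.mul (by fun_prop) hcF) hfin.ne
    rw [← lintegral_zero (μ := P)]
    refine tendsto_lintegral_of_dominated_convergence _
      (fun K => Measurable.mul (by fun_prop) (hcF.sub measurable_const))
      (fun K => Eventually.of_forall fun ω => ?_) hfin.ne ?_
    · exact mul_le_mul_right tsub_le_self _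
    · filter_upwards [hae, h.nonneg] with ω hω hpos
      have hne : pathClearing c (fun q => F q ω) ≠ ⊤ := by
        intro htop
        rw [htop, ENNReal.mul_top] at hω
        · exact lt_irrefl _ hω
        · rw [Ne, ENNReal.ofReal_eq_zero]
          linarith [hpos (Sum.inl 0)]
      obtain ⟨N, hN⟩ := ENNReal.exists_nat_gt hne
      refine tendsto_const_nhds.congr' ?_
      filter_upwards [eventually_ge_atTop N] with K hK
      rw [tsub_eq_zero_of_le (hN.le.trans (by exact_mod_cast hK)), mul_zero]
  refine ⟨fun K => C * J K, fun K => ENNReal.mul_ne_top hC (hJle K).ne, ?_, fun i K => ?_⟩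
  · simpa using ENNReal.Tendsto.const_mul hJlim (Or.inr hC)
  -- The excess of the clearing distance over `K` (truncated subtraction) is again a functional of
  -- the future. The sum over `j` dominates its term at the gap where user `i` lands.
  · refine le_trans ?_ (hbound i (fun z => pathClearing c z - K) (hcm.sub measurable_const))
    rw [← lintegral_tsum]
    · refine lintegral_mono_ae ?_
      filter_upwards [h.ae_goodPath hX0 hY0 hload] with ω hω
      obtain ⟨j, h1, h2, h3⟩ := hω.clearing i
      refine le_trans ?_ (ENNReal.le_tsum j)
      rw [Set.indicator_of_mem]
      · rw [ENNReal.ofReal_sub _ (Nat.cast_nonneg K), ENNReal.ofReal_natCast]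
        exact tsub_le_tsub_right h3 _
      · rw [Finset.sum_range_succ] at h2
        exact ⟨sub_le_iff_le_add.2 h2, h1⟩
    · intro j
      refine (Measurable.indicator ((hcm.comp (h.measurable_shiftedPath j (i + 1))).sub
        measurable_const) ?_).aemeasurable
      exact measurableSet_between (by fun_prop) (by fun_prop) (by fun_prop)

end IsRenewalPair

lemma max_sub_le_add {d a k : ℝ} : max (d - a) 0 ≤ max (d - k) 0 + max (k - a) 0 := by
  refine max_le ?_ (add_nonneg (le_max_right _ _) (le_max_right _ _))
  linarith [le_max_left (d - k) 0, le_max_left (k - a) 0]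

/-- Uniform integrability and nonnegativity make the mean of a steady-state law the limit of the
averaged means. -/
lemma IsSteadyStateLaw.integrable_and_tendsto {Ω : Type*} [MeasurableSpace Ω] {P : Measure Ω}
    [IsProbabilityMeasure P] {D : ℕ → Ω → ℝ} {h : ℕ → ℝ} (hint : ∀ i, Integrable (D i) P)
    (hnn : ∀ i, ∀ᵐ ω ∂P, 0 ≤ D i ω) (hh : Tendsto h atTop (𝓝 0))
    (htail : ∀ n K : ℕ, (n : ℝ)⁻¹ * ∑ i ∈ Finset.range n, ∫ ω, max (D i ω - K) 0 ∂P ≤ h K)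
    {ν : Measure ℝ} (hν : IsSteadyStateLaw P D ν) :
    Integrable (fun x => x) ν ∧ Tendsto (fun n : ℕ => (n : ℝ)⁻¹ * ∑ i ∈ Finset.range n,
      ∫ ω, D i ω ∂P) atTop (𝓝 (∫ x, x ∂ν)) := by
  obtain ⟨hνp, hν⟩ := hν
  let f : ℕ → ℝ →ᵇ ℝ := fun K => BoundedContinuousFunction.ofNormedAddCommGroup
    (fun x : ℝ => min |x| (K : ℝ)) (by fun_prop) K fun x => by
      rw [Real.norm_eq_abs, abs_of_nonneg (le_min (abs_nonneg x) (Nat.cast_nonneg K))]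
      exact min_le_right _ _
  have hf : ∀ K x, f K x = min |x| (K : ℝ) := fun K x => rfl
  let g : ℝ →ᵇ ℝ := BoundedContinuousFunction.ofNormedAddCommGroup
    (fun x : ℝ => min (max (-x) 0) 1) (by fun_prop) 1 fun x => by
      rw [Real.norm_eq_abs, abs_of_nonneg (le_min (le_max_right _ _) zero_le_one)]
      exact min_le_right _ _
  have hg : ∀ x, g x = min (max (-x) 0) 1 := fun x => rfl
  -- The function `g` is positive exactly on the negative half-line, and its means along the
  -- sequence vanish.
  have hpos : ∀ᵐ x ∂ν, 0 ≤ x := by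
    have h1 : ∀ i, ∫ ω, g (D i ω) ∂P = 0 := fun i =>
      integral_eq_zero_of_ae ((hnn i).mono fun ω hω => by
        simp only [hg, max_eq_right (neg_nonpos.2 hω), min_eq_left zero_le_one, Pi.zero_apply])
    have h2 := hν g
    simp only [h1, Finset.sum_const_zero, mul_zero] at h2
    have h3 := tendsto_nhds_unique h2 tendsto_const_nhds
    have h4 := (integral_eq_zero_iff_of_nonneg (f := g) (fun x => le_min (le_max_right _ _) zero_le_one)
      (g.integrable ν)).1 h3
    filter_upwards [h4] with x hx
    rw [hg, Pi.zero_apply] at hx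
    by_contra! hneg
    have : 0 < min (max (-x) 0) 1 := lt_min (lt_max_of_lt_left (by linarith)) one_pos
    linarith
  set A : ℕ → ℝ := fun n => (n : ℝ)⁻¹ * ∑ i ∈ Finset.range n, ∫ ω, D i ω ∂P with hA
  set B : ℕ → ℕ → ℝ := fun K n =>
    (n : ℝ)⁻¹ * ∑ i ∈ Finset.range n, ∫ ω, f K (D i ω) ∂P with hB
  have hfint : ∀ K i, Integrable (fun ω => f K (D i ω)) P := fun K i =>
    Integrable.of_bound ((f K).continuous.comp_aestronglyMeasurable (hint i).aestronglyMeasurable)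
      ‖f K‖ (Eventually.of_forall fun ω => (f K).norm_coe_le_norm _)
  have htint : ∀ (K : ℕ) i, Integrable (fun ω => max (D i ω - K) 0) P := fun K i =>
    ((hint i).sub (integrable_const _)).pos_part
  -- For `D ≥ 0`, `D = min D K + (D - K)⁺`: weak convergence handles the bounded part, `htail` the
  -- rest.
  have hdecomp : ∀ K n, A n = B K n +
      (n : ℝ)⁻¹ * ∑ i ∈ Finset.range n, ∫ ω, max (D i ω - K) 0 ∂P := by
    intro K n
    simp only [hA, hB]
    rw [← mul_add, ← Finset.sum_add_distrib]
    congr 1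
    refine Finset.sum_congr rfl fun i _ => ?_
    rw [← integral_add (hfint K i) (htint K i)]
    refine integral_congr_ae ((hnn i).mono fun ω hω => ?_)
    simp only [hf, abs_of_nonneg hω]
    rcases le_total (D i ω) K with h1 | h1
    · rw [min_eq_left h1, max_eq_right (by linarith), add_zero]
    · rw [min_eq_right h1, max_eq_left (by linarith)]; ring
  have hBA : ∀ K n, B K n ≤ A n := by
    intro K n
    rw [hdecomp K n]
    refine le_add_of_nonneg_right (mul_nonneg (by positivity) (Finset.sum_nonneg fun i _ => ?_))
    exact integral_nonneg fun ω => le_max_right _ _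
  have hAB : ∀ K n, A n ≤ B K n + h K := by
    intro K n
    rw [hdecomp K n]
    exact add_le_add le_rfl (htail n K)
  -- Cutting at `K = 0` leaves no bounded part, so `h 0` bounds all averaged means.
  have hA0 : ∀ n, A n ≤ h 0 := by
    intro n
    have h1 := hAB 0 n
    have h2 : B 0 n = 0 := by
      have : ∀ x, f 0 x = 0 := fun x => by rw [hf, Nat.cast_zero, min_eq_right (abs_nonneg x)]
      simp [hB, this]
    linarith
  have hI : ∀ K, ∫ x, f K x ∂ν ≤ h 0 := fun K =>
    le_of_tendsto' (hν (f K)) fun n => (hBA K n).trans (hA0 n)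
  have hptw : ∀ x, Tendsto (fun K => f K x) atTop (𝓝 |x|) := fun x => by
    refine tendsto_const_nhds.congr' ?_
    filter_upwards [tendsto_natCast_atTop_atTop.eventually_ge_atTop |x|] with K hK
    rw [hf, min_eq_left hK]
  have habs : Integrable (fun x : ℝ => |x|) ν := by
    refine ⟨by fun_prop, ?_⟩
    rw [hasFiniteIntegral_iff_ofReal (Eventually.of_forall fun x => abs_nonneg x)]
    refine lt_of_le_of_lt (le_of_tendsto' (lintegral_tendsto_of_tendsto_of_monotone
      (f := fun K x => ENNReal.ofReal (f K x)) (fun K => ?_) ?_ ?_) fun K => ?_)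
      (ENNReal.ofReal_lt_top (r := h 0))
    · exact ((f K).continuous.measurable.ennreal_ofReal).aemeasurable
    · refine Eventually.of_forall fun x K L hKL => ENNReal.ofReal_le_ofReal ?_
      rw [hf, hf]
      exact min_le_min_left _ (by exact_mod_cast hKL)
    · exact Eventually.of_forall fun x => ENNReal.tendsto_ofReal (hptw x)
    · rw [← ofReal_integral_eq_lintegral_ofReal ((f K).integrable ν)
        (Eventually.of_forall fun x => le_min (abs_nonneg x) (Nat.cast_nonneg K))]
      exact ENNReal.ofReal_le_ofReal (hI K)
  have hid : Integrable (fun x : ℝ => x) ν := (integrable_norm_iff (by fun_prop)).1 habs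
  refine ⟨hid, ?_⟩
  have hlimI : Tendsto (fun K => ∫ x, f K x ∂ν) atTop (𝓝 (∫ x, x ∂ν)) := by
    rw [integral_congr_ae (hpos.mono fun x hx => (abs_of_nonneg hx).symm : _ =ᵐ[ν] fun x => |x|)]
    refine tendsto_integral_of_dominated_convergence _ (fun K => (f K).continuous.aestronglyMeasurable)
      habs (fun K => Eventually.of_forall fun x => ?_) (Eventually.of_forall hptw)
    rw [hf, Real.norm_eq_abs, abs_of_nonneg (le_min (abs_nonneg x) (Nat.cast_nonneg K))]
    exact min_le_left _ _
  rw [Metric.tendsto_atTop] at hh hlimI ⊢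
  intro ε hε
  obtain ⟨K₁, hK₁⟩ := hh (ε / 3) (by positivity)
  obtain ⟨K₂, hK₂⟩ := hlimI (ε / 3) (by positivity)
  have h1 := hK₁ (max K₁ K₂) (le_max_left _ _)
  have h2 := hK₂ (max K₁ K₂) (le_max_right _ _)
  obtain ⟨N, hN⟩ := Metric.tendsto_atTop.1 (hν (f (max K₁ K₂))) (ε / 3) (by positivity)
  refine ⟨N, fun n hn => ?_⟩
  have h3 := hN n hn
  have h4 := hBA (max K₁ K₂) n
  have h5 := hAB (max K₁ K₂) n
  rw [Real.dist_eq, abs_lt] at h1 h2 h3 ⊢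
  simp only [hB] at h4 h5
  constructor <;> linarith [h1.1, h1.2, h2.1, h2.2, h3.1, h3.2]

/-! ### Vanishing of the residual waiting and the final comparison. -/

namespace IsRenewalPair

variable {Ω : Type*} [MeasurableSpace Ω] {P : Measure Ω} {F : ℕ ⊕ ℕ → Ω → ℝ}

/-- The expected part of a time `K` that is left when the next `m + 1` users have arrived. -/
noncomputable def expectedRemainder (P : Measure Ω) (F : ℕ ⊕ ℕ → Ω → ℝ) (K : ℝ) (m : ℕ) : ℝ :=
  ∫ ω, max (K - userLocation F m ω) 0 ∂P

/-- The increment is a sum of `n - i` user gaps, while `userLocation F m` is a sum of `m + 1`; hence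
the index `n - 1 - i`. -/
lemma integral_remainder_eq (h : IsRenewalPair P F) (K : ℝ) {n i : ℕ} (hin : i < n) :
    ∫ ω, max (K - (userLocation F n ω - userLocation F i ω)) 0 ∂P =
      expectedRemainder P F K (n - 1 - i) := by
  obtain ⟨m, rfl⟩ : ∃ m, n = i + (m + 1) := ⟨n - i - 1, by omega⟩
  have hm : i + (m + 1) - 1 - i = m := by omega
  rw [hm]
  have hg : Measurable fun z : ℕ ⊕ ℕ → ℝ =>
      max (K - ∑ l ∈ Finset.range (m + 1), z (Sum.inr l)) 0 := by fun_prop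
  have := ((h.identDistrib_shiftedPath 0 (i + 1)).comp hg).integral_eq
  refine Eq.trans (integral_congr_ae (Eventually.of_forall fun ω => ?_)) this
  simp only [userLocation, Function.comp_apply, shiftedPath, Sum.map_inr]
  rw [pointLocation_add_sub, add_sub_cancel_left]

variable [IsProbabilityMeasure P]

lemma integrable_max_sub_userLocation (h : IsRenewalPair P F) (K : ℝ) (n i : ℕ) :
    Integrable (fun ω => max (K - (userLocation F n ω - userLocation F i ω)) 0) P := by
  have hi : ∀ i, Integrable (userLocation F i) P := fun i =>
    integrable_finsetSum (Finset.range (i + 1)) (f := fun l => F (Sum.inr l))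
      fun l _ => h.integrable_inr l
  exact ((integrable_const K).sub ((hi n).sub (hi i))).pos_part

lemma tendsto_expectedRemainder (h : IsRenewalPair P F)
    (hlim : ∀ᵐ ω ∂P, Tendsto (fun i => userLocation F i ω) atTop atTop) (K : ℝ) :
    Tendsto (expectedRemainder P F K) atTop (𝓝 0) := by
  rw [← integral_zero Ω ℝ (μ := P)]
  refine tendsto_integral_of_dominated_convergence (fun _ => |K|) (fun m => ?_)
    (integrable_const _) (fun m => ?_) ?_
  · have := h.measurable_location Sum.inr m
    exact ((measurable_const.sub this).max measurable_const).aestronglyMeasurable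
  · filter_upwards [h.nonneg] with ω hω
    have h0 : 0 ≤ userLocation F m ω := by
      unfold userLocation pointLocation
      exact Finset.sum_nonneg fun l _ => hω _
    rw [Real.norm_eq_abs, abs_of_nonneg (le_max_right _ _)]
    exact max_le (by linarith [le_abs_self K]) (abs_nonneg K)
  · filter_upwards [hlim] with ω hω
    refine tendsto_const_nhds.congr' ?_
    filter_upwards [hω.eventually_ge_atTop K] with m hm
    rw [max_eq_right (by linarith)]

end IsRenewalPair

/-- The conclusions about the two policies, for the gaps of a pair of renewal processes. -/
lemma IsRenewalPair.compare {Ω : Type*} [MeasurableSpace Ω] {P : Measure Ω}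
    [IsProbabilityMeasure P] {F : ℕ ⊕ ℕ → Ω → ℝ} (h : IsRenewalPair P F) {c : ℕ}
    (hX0 : 0 < ∫ ω, F (Sum.inl 0) ω ∂P) (hY0 : 0 < ∫ ω, F (Sum.inr 0) ω ∂P)
    (hload : ∫ ω, F (Sum.inl 0) ω ∂P < c * ∫ ω, F (Sum.inr 0) ω ∂P) :
    (∀ i, Integrable (ugs F c i) P ∧ Integrable (mtr F c i) P) ∧
    Tendsto (fun n : ℕ => (n : ℝ)⁻¹ * ∑ i ∈ Finset.range n, ∫ ω, ugs F c i ω ∂P -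
      (n : ℝ)⁻¹ * ∑ i ∈ Finset.range n, ∫ ω, mtr F c i ω ∂P) atTop (𝓝 0) ∧
    ∀ νU νM : Measure ℝ, IsSteadyStateLaw P (ugs F c) νU → IsSteadyStateLaw P (mtr F c) νM →
      Integrable (fun x => x) νU ∧ Integrable (fun x => x) νM ∧ ∫ x, x ∂νU = ∫ x, x ∂νM := by
  have hgood := h.ae_goodPath hX0 hY0 hload
  obtain ⟨H, hHtop, hHlim, hH⟩ := h.exists_lintegral_ugs_le hX0 hY0 hload
  have hU0 : ∀ i, ∀ᵐ ω ∂P, 0 ≤ ugs F c i ω := fun i => hgood.mono fun ω hω => hω.ugs_nonneg i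
  have hM0 : ∀ i, ∀ᵐ ω ∂P, 0 ≤ mtr F c i ω := fun i => hgood.mono fun ω hω => hω.mtr_nonneg i
  have hU : ∀ i, Integrable (ugs F c i) P := by
    intro i
    refine ⟨(h.measurable_ugs c i).aestronglyMeasurable, ?_⟩
    rw [hasFiniteIntegral_iff_ofReal (hU0 i)]
    have := hH i 0
    simp only [Nat.cast_zero, sub_zero] at this
    exact this.trans_lt (hHtop 0).lt_top
  have hUK : ∀ i (a : ℝ), Integrable (fun ω => max (ugs F c i ω - a) 0) P := fun i a =>
    ((hU i).sub (integrable_const _)).pos_part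
  have hM : ∀ i, Integrable (mtr F c i) P := by
    intro i
    -- A single MTR distance is at most the total UGS distance of the first `i + 1` users.
    refine (integrable_finsetSum (Finset.range (i + 1)) fun l _ => hUK l 0).mono'
      (h.measurable_mtr c i).aestronglyMeasurable (hgood.mono fun ω hω => ?_)
    rw [Real.norm_eq_abs, abs_of_nonneg (hω.mtr_nonneg i)]
    refine le_trans ?_ (hω.sum_mtr_le 0 (i + 1))
    refine le_trans ?_ (Finset.single_le_sum (f := fun l => max (mtr F c l ω - 0) 0)
      (fun l _ => le_max_right _ _) (Finset.self_mem_range_succ i))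
    simp
  have hMK : ∀ i (a : ℝ), Integrable (fun ω => max (mtr F c i ω - a) 0) P := fun i a =>
    ((hM i).sub (integrable_const _)).pos_part
  have hlim : Tendsto (fun K => (H K).toReal) atTop (𝓝 0) := by
    simpa [Function.comp_def] using (ENNReal.tendsto_toReal ENNReal.zero_ne_top).comp hHlim
  have hUtail : ∀ i (K : ℕ), ∫ ω, max (ugs F c i ω - K) 0 ∂P ≤ (H K).toReal := by
    intro i K
    rw [integral_eq_lintegral_of_nonneg_ae (f := fun ω => max (ugs F c i ω - K) 0)
      (Eventually.of_forall fun ω => le_max_right _ _)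
      (hUK i K).aestronglyMeasurable]
    refine ENNReal.toReal_mono (hHtop K) (le_trans (le_of_eq ?_) (hH i K))
    refine lintegral_congr fun ω => ?_
    rw [ENNReal.ofReal_max]
    simp
  have hUsum : ∀ n K : ℕ, (n : ℝ)⁻¹ * ∑ i ∈ Finset.range n, ∫ ω, max (ugs F c i ω - K) 0 ∂P ≤
      (H K).toReal := by
    intro n K
    rcases Nat.eq_zero_or_pos n with h0 | h0
    · simp [h0]
    · rw [inv_mul_le_iff₀ (by exact_mod_cast h0)]
      refine (Finset.sum_le_sum fun i _ => hUtail i K).trans ?_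
      simp
  have hMsum : ∀ n K : ℕ, (n : ℝ)⁻¹ * ∑ i ∈ Finset.range n, ∫ ω, max (mtr F c i ω - K) 0 ∂P ≤
      (H K).toReal := by
    intro n K
    refine le_trans (mul_le_mul_of_nonneg_left ?_ (by positivity)) (hUsum n K)
    rw [← integral_finsetSum _ fun i _ => hMK i K, ← integral_finsetSum _ fun i _ => hUK i K]
    exact integral_mono_ae (integrable_finsetSum _ fun i _ => hMK i K)
      (integrable_finsetSum _ fun i _ => hUK i K) (hgood.mono fun ω hω => hω.sum_mtr_le K n)
  have hdiff : Tendsto (fun n : ℕ => (n : ℝ)⁻¹ * ∑ i ∈ Finset.range n, ∫ ω, ugs F c i ω ∂P -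
      (n : ℝ)⁻¹ * ∑ i ∈ Finset.range n, ∫ ω, mtr F c i ω ∂P) atTop (𝓝 0) := by
    have hlow : ∀ n : ℕ, 0 ≤ (n : ℝ)⁻¹ * ∑ i ∈ Finset.range n, ∫ ω, ugs F c i ω ∂P -
        (n : ℝ)⁻¹ * ∑ i ∈ Finset.range n, ∫ ω, mtr F c i ω ∂P := by
      intro n
      rw [sub_nonneg]
      refine mul_le_mul_of_nonneg_left ?_ (by positivity)
      rw [← integral_finsetSum _ fun i _ => hM i, ← integral_finsetSum _ fun i _ => hU i]
      refine integral_mono_ae (integrable_finsetSum _ fun i _ => hM i)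
        (integrable_finsetSum _ fun i _ => hU i) (hgood.mono fun ω hω => ?_)
      simpa only [sub_zero, max_eq_left (hω.ugs_nonneg _), max_eq_left (hω.mtr_nonneg _)]
        using hω.sum_mtr_le 0 n
    -- The trip of user `i` beyond user `n` is `(D_i^U - a)⁺` with `a = r_n - r_i`, and it is at
    -- most `(D_i^U - K)⁺ + (K - a)⁺`. Reversing the order of summation makes the second part a
    -- Cesàro sum.
    have hup : ∀ n K : ℕ, (n : ℝ)⁻¹ * ∑ i ∈ Finset.range n, ∫ ω, ugs F c i ω ∂P -
        (n : ℝ)⁻¹ * ∑ i ∈ Finset.range n, ∫ ω, mtr F c i ω ∂P ≤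
        (H K).toReal + (n : ℝ)⁻¹ * ∑ m ∈ Finset.range n, expectedRemainder P F K m := by
      intro n K
      have h1 : ∑ i ∈ Finset.range n, ∫ ω, ugs F c i ω ∂P ≤
          ∑ i ∈ Finset.range n, ∫ ω, mtr F c i ω ∂P +
          (∑ i ∈ Finset.range n, ∫ ω, max (ugs F c i ω - K) 0 ∂P +
          ∑ i ∈ Finset.range n,
            ∫ ω, max (K - (userLocation F n ω - userLocation F i ω)) 0 ∂P) := by
        have iR := integrable_finsetSum (Finset.range n)
          fun i _ => h.integrable_max_sub_userLocation K n i
        have iM := integrable_finsetSum (Finset.range n) fun i _ => hM i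
        have iK := integrable_finsetSum (Finset.range n) fun i _ => hUK i K
        rw [← integral_finsetSum _ fun i _ => hM i, ← integral_finsetSum _ fun i _ => hU i,
          ← integral_finsetSum _ fun i _ => hUK i K, ← integral_finsetSum _ fun i _ =>
            h.integrable_max_sub_userLocation K n i, ← integral_add' iK iR,
          ← integral_add' iM (iK.add iR)]
        refine integral_mono_ae (integrable_finsetSum _ fun i _ => hU i) (iM.add (iK.add iR))
          (hgood.mono fun ω hω => ?_)
        simp only [Pi.add_apply]
        refine (hω.sum_ugs_le n).trans (add_le_add le_rfl ?_)
        rw [← Finset.sum_add_distrib]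
        exact Finset.sum_le_sum fun i _ => max_sub_le_add
      have h2 : ∑ i ∈ Finset.range n,
          ∫ ω, max (K - (userLocation F n ω - userLocation F i ω)) 0 ∂P =
          ∑ m ∈ Finset.range n, expectedRemainder P F K m := by
        rw [← Finset.sum_range_reflect (expectedRemainder P F K)]
        exact Finset.sum_congr rfl fun i hi =>
          h.integral_remainder_eq K (Finset.mem_range.1 hi)
      rw [h2] at h1
      have h3 := mul_le_mul_of_nonneg_left h1 (by positivity : (0 : ℝ) ≤ (n : ℝ)⁻¹)
      rw [mul_add, mul_add] at h3
      linarith [hUsum n K]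
    rw [Metric.tendsto_atTop]
    intro ε hε
    obtain ⟨K, hK⟩ := (hlim.eventually_lt_const (half_pos hε)).exists
    have hces := (h.tendsto_expectedRemainder
      (hgood.mono fun ω hω => hω.tendsto_userLocation) K).cesaro
    obtain ⟨N, hN⟩ := eventually_atTop.1 (hces.eventually_lt_const (half_pos hε))
    refine ⟨N, fun n hn => ?_⟩
    rw [Real.dist_eq, sub_zero, abs_of_nonneg (hlow n)]
    linarith [hup n K, hN n hn]
  refine ⟨fun i => ⟨hU i, hM i⟩, hdiff, fun νU νM hνU hνM => ?_⟩
  obtain ⟨hUi, hUt⟩ := hνU.integrable_and_tendsto hU hU0 hlim hUsum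
  obtain ⟨hMi, hMt⟩ := hνM.integrable_and_tendsto hM hM0 hlim hMsum
  exact ⟨hUi, hMi, sub_eq_zero.1 (tendsto_nhds_unique (hUt.sub hMt) hdiff)⟩

theorem corollary1 {Ω : Type*} [MeasurableSpace Ω] (P : Measure Ω) [IsProbabilityMeasure P]
    (X Y : ℕ → Ω → ℝ) (c : ℕ)
    (hXm : ∀ j, Measurable (X j)) (hYm : ∀ i, Measurable (Y i))
    (hindep : iIndepFun (Sum.elim X Y) P)
    (hXid : ∀ j, IdentDistrib (X j) (X 0) P P) (hYid : ∀ i, IdentDistrib (Y i) (Y 0) P P)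
    (hX0 : ∀ᵐ ω ∂P, 0 ≤ X 0 ω) (hY0 : ∀ᵐ ω ∂P, 0 ≤ Y 0 ω)
    (hX2 : MemLp (X 0) 2 P) (hY2 : MemLp (Y 0) 2 P)
    (hXpos : 0 < ∫ ω, X 0 ω ∂P) (hYpos : 0 < ∫ ω, Y 0 ω ∂P)
    (hload : (1 / ∫ ω, Y 0 ω ∂P) / (1 / ∫ ω, X 0 ω ∂P) < (c : ℝ)) :
    -- almost surely every user is allocated to a server under both policies
    (∀ᵐ ω ∂P, ∀ i,
      (ugsServer (pointLocation (Y · ω)) (pointLocation (X · ω)) c i).isSome ∧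
      (mtrServer (pointLocation (Y · ω)) (pointLocation (X · ω)) c i).isSome) ∧
    -- every request distance has a finite expectation under both policies
    (∀ i, Integrable (fun ω => ugsDistance (X · ω) (Y · ω) c i) P ∧
      Integrable (fun ω => mtrDistance (X · ω) (Y · ω) c i) P) ∧
    -- the long-run averages of the expected request distances agree
    Tendsto (fun n : ℕ =>
        (n : ℝ)⁻¹ * ∑ i ∈ Finset.range n, ∫ ω, ugsDistance (X · ω) (Y · ω) c i ∂P -
        (n : ℝ)⁻¹ * ∑ i ∈ Finset.range n, ∫ ω, mtrDistance (X · ω) (Y · ω) c i ∂P)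
      atTop (𝓝 0) ∧
    -- the steady-state request distances have the same finite expectation
    (∀ νU νM : Measure ℝ,
      IsSteadyStateLaw P (fun i ω => ugsDistance (X · ω) (Y · ω) c i) νU →
      IsSteadyStateLaw P (fun i ω => mtrDistance (X · ω) (Y · ω) c i) νM →
      Integrable (fun x => x) νU ∧ Integrable (fun x => x) νM ∧
        ∫ x, x ∂νU = ∫ x, x ∂νM) := by
  have hF : IsRenewalPair P (Sum.elim X Y) := by
    refine ⟨fun k => ?_, hindep, hXid, hYid, ?_, hX2, hY2.integrable one_le_two⟩
    · rcases k with j | i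
      · exact hXm j
      · exact hYm i
    · refine ae_all_iff.2 fun k => ?_
      rcases k with j | i
      · exact (hXid j).symm.ae_snd measurableSet_Ici hX0
      · exact (hYid i).symm.ae_snd measurableSet_Ici hY0
  have hload' : ∫ ω, X 0 ω ∂P < c * ∫ ω, Y 0 ω ∂P := by
    rwa [div_div_div_eq, one_mul, mul_one, div_lt_iff₀ hYpos] at hload
  obtain ⟨h1, h2, h3⟩ := hF.compare (c := c) hXpos hYpos hload'
  refine ⟨?_, h1, h2, h3⟩
  filter_upwards [hF.ae_goodPath (c := c) hXpos hYpos hload'] with ω hω i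
  exact ⟨hω.isSome_ugs i, hω.isSome_mtr i⟩
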